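/- Let $s\in(0,1)$, $T>0$, $a=1-2s$, and let $k:\mathbb R\to\mathbb R$ be a measurable, bounded, $T$-periodic function. Put $$Lu:=(-\partial_{xx})^s u+k(x)u,$$ where $(-\partial_{xx})^s$ is the Fourier multiplier with symbol $|\xi|^{2s}$. Let $L^2_T$ be the space of real-valued $T$-periodic functions on $\mathbb R$ that are square integrable over $(-T/2,T/2)$, functions equal almost everywhere being identified. Let $\mathcal H_T$ be the space of real-valued functions $U(x,y)$ on $\mathbb R\times[0,\infty)$ that are $T$-periodic in $x$ and weakly differentiable for $y>0$, with trace $U(\cdot,0)$ on $y=0$, and satisfy $$\int_{-T/2}^{T/2}\int_0^\infty y^a|\nabla U(x,y)|^2\,dy\,dx+\int_{-T/2}^{T/2}U(x,0)^2\,dx<\infty .$$ For $U,V\in\mathcal H_T$ let $$B(U,V)=d_s\int_{-T/2}^{T/2}\int_0^\infty y^a\,\nabla U\cdot\nabla V\,dy\,dx+\int_{-T/2}^{T/2}k(x)U(x,0)V(x,0)\,dx,\qquad d_s=2^{2s-1}\frac{\Gamma(s)}{\Gamma(1-s)} .$$ For $f\in L^2_T$, a weak periodic solution of $Lu=f$ is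 a function $u=U(\cdot,0)$ with $U\in\mathcal H_T$ such that $$B(U,V)=\int_{-T/2}^{T/2}f(x)V(x,0)\,dx\qquad\text{for all }V\in\mathcal H_T ;$$ for $\lambda\in\mathbb R$ and $g\in L^2_T$, a weak periodic solution of $Lu=\lambda u+g$ is such a $u$ with $f=\lambda u+g$. A number $\lambda\in\mathbb R$ is an eigenvalue of $L$ if $Lu=\lambda u$ has a weak periodic solution $u\not\equiv0$. **Theorem.** (i) There exists an at most countable set $\Lambda\subset\mathbb R$ of eigenvalues of $L$ such that, for every $\lambda\in\mathbb R$, the equation $$Lu=\lambda u+g$$ has a unique weak periodic solution $u$ for each $g\in L^2_T$ if and only if $\lambda\notin\Lambda$. (ii) If $\Lambda$ is infinite, then $\Lambda=\{\lambda_j\}_{j=1}^\infty$ is the set of values of a nondecreasing sequence with $\lambda_j\to+\infty$. -/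

import Mathlib

open MeasureTheory Set Filter Topology
open scoped ContDiff

noncomputable section

namespace PeriodicFractional

/-- One period `(-T/2, T/2]`. -/
def period (T : ℝ) : Set ℝ := Ioc (-(T / 2)) (T / 2)

/-- The half-strip `(-T/2, T/2] × (0, ∞)`, one period of the upper half-plane. -/
def strip (T : ℝ) : Set (ℝ × ℝ) := period T ×ˢ Ioi 0

/-- The weighted measure `y ^ a dx dy`, `a = 1 - 2 s`, on the half-strip. -/
def weight (s T : ℝ) : Measure (ℝ × ℝ) :=
  (volume.restrict (strip T)).withDensity fun p => ENNReal.ofReal (p.2 ^ (1 - 2 * s))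

/-- `L²_T`: the `T`-periodic real functions that are square integrable over a period. -/
structure MemL2 (T : ℝ) (u : ℝ → ℝ) : Prop where
  periodic : Function.Periodic u T
  memLp : MemLp u 2 (volume.restrict (period T))

/-- Smooth functions of `(x, y)`, `T`-periodic in `x` and vanishing for large `|y|`: the test
functions on the cylinder. They need not vanish at `y = 0`. -/
structure IsTest (T : ℝ) (φ : ℝ × ℝ → ℝ) : Prop where
  smooth : ContDiff ℝ ∞ φ
  periodic : ∀ x y, φ (x + T, y) = φ (x, y)
  support : ∃ R : ℝ, ∀ x y, R ≤ |y| → φ (x, y) = 0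

/-- `U`, defined on the closed half-plane and `T`-periodic in `x`, belongs to the energy space
`𝓗_T`, with weak gradient `(P, Q)` in the open half-plane:
`∫∫ y ^ a (P² + Q²) dx dy + ∫ U(x, 0)² dx < ∞`, the integrals being over one period.
As the test functions need not vanish on `y = 0`, the second integration by parts formula says
both that `Q = ∂U/∂y` weakly and that `x ↦ U (x, 0)` is the trace of `U` on `y = 0`. -/
structure MemEnergy (s T : ℝ) (U P Q : ℝ × ℝ → ℝ) : Prop where
  periodic : ∀ x y, 0 ≤ y → U (x + T, y) = U (x, y)
  locallyIntegrable : ∀ R : ℝ, IntegrableOn U (period T ×ˢ Ioc 0 R)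
  trace_mem : MemL2 T fun x => U (x, 0)
  memLp_dx : MemLp P 2 (weight s T)
  memLp_dy : MemLp Q 2 (weight s T)
  weak_dx : ∀ φ, IsTest T φ →
    ∫ p in strip T, U p * fderiv ℝ φ p (1, 0) = -∫ p in strip T, P p * φ p
  weak_dy : ∀ φ, IsTest T φ →
    ∫ p in strip T, U p * fderiv ℝ φ p (0, 1) =
      -(∫ p in strip T, Q p * φ p) - ∫ x in period T, U (x, 0) * φ (x, 0)

/-- The constant `d_s` in `(-∂ₓₓ)^s u = d_s · (-lim_{y ↓ 0} y ^ a ∂U/∂y)`,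
where `U` is the `s`-harmonic extension of `u`. -/
def dConst (s : ℝ) : ℝ := 2 ^ (2 * s - 1) * Real.Gamma s / Real.Gamma (1 - s)

/-- The bilinear form of `L = (-∂ₓₓ)^s + k` on the energy space, in terms of the functions `U`, `V`
and their weak gradients `(P, Q)`, `(P', Q')`. -/
def form (s T : ℝ) (k : ℝ → ℝ) (U P Q V P' Q' : ℝ × ℝ → ℝ) : ℝ :=
  dConst s * ∫ p, (P p * P' p + Q p * Q' p) ∂weight s T
    + ∫ x in period T, k x * U (x, 0) * V (x, 0)

/-- `u` is a weak `T`-periodic solution of `(-∂ₓₓ)^s u + k u = f`: it is the trace of some `U` in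
the energy space with `B(U, V) = ⟨f, V(·, 0)⟩` for every `V` in the energy space. -/
def IsWeakSolution (s T : ℝ) (k f u : ℝ → ℝ) : Prop :=
  ∃ U P Q : ℝ × ℝ → ℝ, MemEnergy s T U P Q ∧ (∀ x, U (x, 0) = u x) ∧
    ∀ V P' Q' : ℝ × ℝ → ℝ, MemEnergy s T V P' Q' →
      form s T k U P Q V P' Q' = ∫ x in period T, f x * V (x, 0)

/-- `L u = lam u + g` has a weak solution, unique up to equality almost everywhere. -/
def UniquelySolvable (s T : ℝ) (k : ℝ → ℝ) (lam : ℝ) (g : ℝ → ℝ) : Prop :=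
  (∃ u : ℝ → ℝ, IsWeakSolution s T k (fun x => lam * u x + g x) u) ∧
    ∀ u v : ℝ → ℝ, IsWeakSolution s T k (fun x => lam * u x + g x) u →
      IsWeakSolution s T k (fun x => lam * v x + g x) v → u =ᵐ[volume] v

/-- `lam` is an eigenvalue: `L u = lam u` has a nonzero weak solution. -/
def IsEigenvalue (s T : ℝ) (k : ℝ → ℝ) (lam : ℝ) : Prop :=
  ∃ u : ℝ → ℝ, IsWeakSolution s T k (fun x => lam * u x) u ∧ ¬ u =ᵐ[volume] 0

end PeriodicFractional

end

/-! The theorem is the Fredholm alternative for a symmetric form `B` that satisfies a Gårding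
inequality `c‖h‖² ≤ B(h,h) + m‖J h‖²` relative to the compact trace operator `J`. Adding `m⟨J·,J·⟩`
makes `B` coercive, so by Lax–Milgram the equation becomes one for a compact operator: solvability
can fail only at eigenvalues (`exists_solution_of_garding`). Eigenvectors for distinct eigenvalues
have orthogonal traces. If infinitely many eigenvalues lay below some bound, the eigenvectors with
traces of norm one would be bounded, and compactness would be violated
(`finite_eigenvalues_of_garding`). The set of all eigenvalues therefore has finite initial segments,
which gives countability and the enumeration.

Two facts tie this to the problem.

Hilbert space. A function of finite energy enters `B` only through its trace `u` and weak gradient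
`(P, Q)`. Eliminating `U` from the two integration by parts formulas leaves one linear constraint on
`(u, P, Q)`: zero curl, with tangential boundary value `u'`. The triples satisfying it form a closed
subspace of a product of `L²` spaces. Conversely `U(x,y) = u(x) + ∫₀^y Q(x,t) dt` recovers a
function from each such triple (`memEnergy_extension`).

Compactness. Testing the constraint with frequency `n` times a cutoff in `y` at scale `1/(|n|+1)`
bounds the `n`-th trigonometric coefficient of the trace by pairings of the gradient with orthogonal
functions of squared norm `O(|n|^(-2s))`. Bessel's inequality gives uniformly small tails as `s > 0`
(`isCompactOperator_traceMap`). -/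

open scoped InnerProductSpace

/-! ### Abstract spectral theory of forms with a Gårding inequality. -/

section AbstractForms

variable {H L : Type*} [NormedAddCommGroup H] [InnerProductSpace ℝ H]
  [NormedAddCommGroup L] [InnerProductSpace ℝ L]

/-- A bounded operator whose coefficients in a Hilbert basis have uniformly small tails is
compact. -/
theorem isCompactOperator_of_hilbertBasis_tails {ι : Type*} [CompleteSpace L]
    (b : HilbertBasis ι ℝ L) (J : H →L[ℝ] L)
    (h : ∀ ε > 0, ∃ s : Finset ι, ∀ x, ∀ t : Finset ι, Disjoint t s →
      ∑ i ∈ t, ⟪b i, J x⟫_ℝ ^ 2 ≤ ε ^ 2 * ‖x‖ ^ 2) : IsCompactOperator J := by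
  classical
  have hcl : IsClosed {f : H →L[ℝ] L | IsCompactOperator f} := isClosed_setOfPred_isCompactOperator
  -- Compact operators are norm closed, so it suffices to approximate `J` by its finite-rank
  -- truncations to `s`; the tail bound is taken at `ε / 2` to make the distance strictly less than
  -- `ε`.
  refine hcl.closure_subset (Metric.mem_closure_iff.2 fun ε hε => ?_)
  obtain ⟨s, hs⟩ := h (ε / 2) (by positivity)
  let F : H →L[ℝ] L := ∑ i ∈ s, ((ContinuousLinearMap.toSpanSingleton ℝ (b i)).comp
    ((innerSL ℝ (b i)).comp J))
  have hF : ∀ x, F x = ∑ i ∈ s, ⟪b i, J x⟫_ℝ • b i := fun x => by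
    simp [F]
  refine ⟨F, ?_, ?_⟩
  · have : F ∈ compactOperator (RingHom.id ℝ) H L := by
      refine Submodule.sum_mem _ fun i _ => ?_
      exact (isCompactOperator_of_locallyCompactSpace_rng
        (ContinuousLinearMap.toSpanSingleton ℝ (b i))).comp_clm _
    exact this
  · rw [dist_eq_norm]
    refine lt_of_le_of_lt (ContinuousLinearMap.opNorm_le_bound _ (by positivity : 0 ≤ ε / 2)
      fun x => ?_) (by linarith)
    have hc : ∀ i, ⟪b i, (J - F) x⟫_ℝ = if i ∈ s then 0 else ⟪b i, J x⟫_ℝ := fun i => by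
      have := orthonormal_iff_ite.1 b.orthonormal
      simp only [sub_apply, hF, inner_sub_right, inner_sum, inner_smul_right,
        this, mul_ite, mul_one, mul_zero, Finset.sum_ite_eq]
      split_ifs <;> simp
    have hn : HasSum (fun i => ⟪b i, (J - F) x⟫_ℝ ^ 2) (‖(J - F) x‖ ^ 2) := by
      have := b.hasSum_inner_mul_inner ((J - F) x) ((J - F) x)
      rw [real_inner_self_eq_norm_sq] at this
      refine this.congr_fun ?_
      intro i
      rw [real_inner_comm, sq]
    have : ‖(J - F) x‖ ^ 2 ≤ (ε / 2) ^ 2 * ‖x‖ ^ 2 := by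
      refine hasSum_le_of_sum_le hn fun t => ?_
      have h1 := hs x (t.filter (· ∉ s)) (by
        rw [Finset.disjoint_left]; intro a ha; exact (Finset.mem_filter.1 ha).2)
      refine le_trans (le_of_eq ?_) h1
      rw [Finset.sum_filter]
      refine Finset.sum_congr rfl fun i _ => ?_
      rw [hc]; by_cases hi : i ∈ s <;> simp [hi]
    rw [← mul_pow] at this
    exact le_of_sq_le_sq this (by positivity)

/-- Bessel's inequality for an orthogonal family of bounded norm. -/
theorem sum_inner_sq_le_of_orthogonal {ι : Type*} (v : ι → L) (t : Finset ι) {r : ℝ}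
    (hv : ∀ i ∈ t, ‖v i‖ ≤ r) (ho : ∀ i ∈ t, ∀ j ∈ t, i ≠ j → ⟪v i, v j⟫_ℝ = 0) (x : L) :
    ∑ i ∈ t, ⟪v i, x⟫_ℝ ^ 2 ≤ r ^ 2 * ‖x‖ ^ 2 := by
  classical
  -- With `y = ∑ ⟨v i, x⟩ v i`, one has `S = ⟨y, x⟩` and, by orthogonality, `‖y‖² ≤ r² S`.
  -- Cauchy–Schwarz gives `S² ≤ r² S ‖x‖²`, and one factor `S` cancels.
  set S := ∑ i ∈ t, ⟪v i, x⟫_ℝ ^ 2 with hS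
  have hS0 : 0 ≤ S := Finset.sum_nonneg fun i _ => sq_nonneg _
  set y := ∑ i ∈ t, ⟪v i, x⟫_ℝ • v i with hy
  have h1 : ⟪y, x⟫_ℝ = S := by
    rw [hy, sum_inner, hS]
    refine Finset.sum_congr rfl fun i _ => ?_
    rw [real_inner_smul_left, sq]
  have h2 : ‖y‖ ^ 2 ≤ r ^ 2 * S := by
    rw [← real_inner_self_eq_norm_sq, hy, sum_inner, hS, Finset.mul_sum]
    refine Finset.sum_le_sum fun i hi => ?_
    rw [inner_sum, Finset.sum_eq_single i]
    · rw [real_inner_smul_left, real_inner_smul_right, real_inner_self_eq_norm_sq]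
      have := pow_le_pow_left₀ (norm_nonneg _) (hv i hi) 2
      nlinarith [sq_nonneg ⟪v i, x⟫_ℝ]
    · intro j hj hji
      rw [real_inner_smul_left, real_inner_smul_right, ho i hi j hj hji.symm]; simp
    · exact fun h => (h hi).elim
  have h3 : S ≤ ‖y‖ * ‖x‖ := h1 ▸ real_inner_le_norm y x
  have h4 : S ^ 2 ≤ (r ^ 2 * S) * ‖x‖ ^ 2 := by
    calc S ^ 2 ≤ (‖y‖ * ‖x‖) ^ 2 := pow_le_pow_left₀ hS0 h3 2
      _ = ‖y‖ ^ 2 * ‖x‖ ^ 2 := by ring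
      _ ≤ _ := by gcongr
  rcases hS0.eq_or_lt with h0 | h0
  · rw [← h0]; positivity
  · nlinarith

/-- A symmetric form that satisfies a Gårding inequality relative to a compact operator has only
finitely many eigenvalues below any given bound. -/
theorem finite_eigenvalues_of_garding (J : H →L[ℝ] L) (hJ : IsCompactOperator J)
    (B : H →L[ℝ] H →L[ℝ] ℝ) (hsymm : ∀ h h', B h h' = B h' h) {c m : ℝ} (hc : 0 < c)
    (hB : ∀ h, c * ‖h‖ ^ 2 ≤ B h h + m * ‖J h‖ ^ 2) (C : ℝ) :
    {lam : ℝ | lam ≤ C ∧ ∃ h, h ≠ 0 ∧ ∀ h', B h h' = lam * ⟪J h, J h'⟫_ℝ}.Finite := by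
  by_contra hinf
  let f := Set.Infinite.natEmbedding _ hinf
  have hf : ∀ n, (f n : ℝ) ≤ C ∧ ∃ h, h ≠ 0 ∧ ∀ h', B h h' = f n * ⟪J h, J h'⟫_ℝ :=
    fun n => (f n).2
  have hfi : ∀ n k, n ≠ k → (f n : ℝ) ≠ f k := fun n k hnk e =>
    hnk (f.injective (Subtype.ext e))
  choose hle h h0 he using hf
  -- If `J (h n) = 0` then `B (h n) (h n) = 0`, and the Gårding inequality forces `h n = 0`. Hence
  -- the eigenvectors can be normalised through `J`.
  have hJ0 : ∀ n, ‖J (h n)‖ ≠ 0 := fun n e => by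
    have h1 := hB (h n)
    rw [he n, real_inner_self_eq_norm_sq, e] at h1
    have h2 : 0 < ‖h n‖ := norm_pos_iff.2 (h0 n)
    nlinarith [mul_pos hc (pow_pos h2 2)]
  let v : ℕ → H := fun n => ‖J (h n)‖⁻¹ • h n
  have hv : ∀ n h', B (v n) h' = f n * ⟪J (v n), J h'⟫_ℝ := fun n h' => by
    simp only [v, map_smul, smul_apply, he n, real_inner_smul_left,
      smul_eq_mul]
    ring
  have hv1 : ∀ n, ‖J (v n)‖ = 1 := fun n => by
    simp only [v, map_smul, norm_smul, norm_inv, norm_norm]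
    exact inv_mul_cancel₀ (hJ0 n)
  have horth : ∀ n k, n ≠ k → ⟪J (v n), J (v k)⟫_ℝ = 0 := fun n k hnk => by
    have h1 := hv n (v k)
    rw [hsymm, hv k, real_inner_comm] at h1
    have h2 : ((f n : ℝ) - f k) * ⟪J (v n), J (v k)⟫_ℝ = 0 := by linarith
    exact (mul_eq_zero.1 h2).resolve_left (sub_ne_zero.2 (hfi n k hnk))
  have hbd : ∀ n, ‖v n‖ ^ 2 ≤ (C + m) / c := fun n => by
    rw [le_div_iff₀ hc]
    have h1 := hB (v n)
    rw [hv n, real_inner_self_eq_norm_sq, hv1] at h1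
    linarith [hle n]
  obtain ⟨K, hK, hK'⟩ := hJ.image_closedBall_subset_compact (𝕜₁ := ℝ) (f := (J : H →ₗ[ℝ] L))
    (√((C + m) / c))
  obtain ⟨y, -, φ, hφ, hlim⟩ := hK.tendsto_subseq (x := fun n => J (v n)) fun n =>
    hK' ⟨v n, by simpa using Real.le_sqrt_of_sq_le (hbd n), rfl⟩
  -- Orthonormal vectors are at distance `√2 > 1`, so no subsequence is Cauchy.
  obtain ⟨N, hN⟩ := Metric.cauchySeq_iff'.1 hlim.cauchySeq 1 one_pos
  have h1 := hN (N + 1) (by omega)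
  have hne : φ (N + 1) ≠ φ N := (hφ (Nat.lt_succ_self N)).ne'
  rw [dist_eq_norm] at h1
  have h2 := norm_sub_sq_real (J (v (φ (N + 1)))) (J (v (φ N)))
  rw [horth _ _ hne, hv1, hv1] at h2
  simp only [Function.comp_apply] at h1
  nlinarith [norm_nonneg (J (v (φ (N + 1))) - J (v (φ N)))]

variable (L) in
/-- The inner product of a real Hilbert space as a bounded bilinear form. -/
noncomputable def realInnerCLM : L →L[ℝ] L →L[ℝ] ℝ :=
  (innerₗ L).mkContinuous₂ 1 fun x y => by simpa using abs_real_inner_le_norm x y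

variable [CompleteSpace H] [CompleteSpace L]

/-- The Fredholm alternative for a bounded form `B` that satisfies a Gårding inequality relative
to a compact operator `J`. -/
theorem exists_solution_of_garding (J : H →L[ℝ] L) (hJ : IsCompactOperator J)
    (B : H →L[ℝ] H →L[ℝ] ℝ) {c m : ℝ} (hc : 0 < c)
    (hB : ∀ h, c * ‖h‖ ^ 2 ≤ B h h + m * ‖J h‖ ^ 2) (lam : ℝ)
    (hinj : ∀ h, (∀ h', B h h' = lam * ⟪J h, J h'⟫_ℝ) → h = 0) (g : L) :
    ∃ h, ∀ h', B h h' = lam * ⟪J h, J h'⟫_ℝ + ⟪g, J h'⟫_ℝ := by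
  set Bm : H →L[ℝ] H →L[ℝ] ℝ := B + m • (realInnerCLM L).bilinearComp J J with hBm
  have hBm' : ∀ h h', Bm h h' = B h h' + m * ⟪J h, J h'⟫_ℝ := fun h h' => by
    simp [hBm, realInnerCLM]
  have hco : IsCoercive Bm := ⟨c, hc, fun u => by
    rw [hBm', real_inner_self_eq_norm_sq]; nlinarith [hB u]⟩
  set A := hco.continuousLinearEquivOfBilin
  have hA : ∀ v w, ⟪A v, w⟫_ℝ = Bm v w := hco.continuousLinearEquivOfBilin_apply
  set Jt := ContinuousLinearMap.adjoint J
  have hJt : ∀ g h, ⟪Jt g, h⟫_ℝ = ⟪g, J h⟫_ℝ := fun g h =>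
    ContinuousLinearMap.adjoint_inner_left J h g
  have key : ∀ h g, A h = (lam + m) • Jt (J h) + Jt g →
      ∀ h', B h h' = lam * ⟪J h, J h'⟫_ℝ + ⟪g, J h'⟫_ℝ := fun h g e h' => by
    have := hA h h'
    rw [e, inner_add_left, real_inner_smul_left, hJt, hJt, hBm'] at this
    linarith
  -- The equation reads `A h = (lam + m) J* J h + J* g`. If `lam + m = 0` it is solved by inverting
  -- `A`. Otherwise it is `((lam + m)⁻¹ - K) h = (lam + m)⁻¹ A⁻¹ J* g` with `K = A⁻¹ J* J` compact;
  -- an eigenvector of `K` for `(lam + m)⁻¹` would contradict `hinj`.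
  by_cases hν : lam + m = 0
  · refine ⟨A.symm (Jt g), key _ _ ?_⟩
    simp [hν]
  let K : H →L[ℝ] H := (A.symm : H →L[ℝ] H).comp (Jt.comp J)
  have hK : IsCompactOperator K := (hJ.clm_comp Jt).clm_comp (A.symm : H →L[ℝ] H)
  rcases hK.hasEigenvalue_or_mem_resolventSet (inv_ne_zero hν) with he | hr
  · obtain ⟨v, hv⟩ := he.exists_hasEigenvector
    refine (hv.2 (hinj v fun h' => ?_)).elim
    have e : K v = (lam + m)⁻¹ • v := hv.apply_eq_smul
    have e2 : Jt (J v) = (lam + m)⁻¹ • A v := by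
      rw [← map_smul, ← e]; simp [K]
    have := key v 0 (by rw [e2, smul_smul, mul_inv_cancel₀ hν]; simp) h'
    simpa using this
  · rw [spectrum.mem_resolventSet_iff, ContinuousLinearMap.isUnit_iff_bijective] at hr
    obtain ⟨h, hh⟩ := hr.2 ((lam + m)⁻¹ • A.symm (Jt g))
    refine ⟨h, key _ _ ?_⟩
    have e : (lam + m)⁻¹ • h - A.symm (Jt (J h)) = (lam + m)⁻¹ • A.symm (Jt g) := by
      rw [← hh]; simp [K, Algebra.algebraMap_eq_smul_one]
    apply_fun (fun z => (lam + m) • A z) at e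
    simp only [map_sub, map_smul, ContinuousLinearEquiv.apply_symm_apply, smul_sub, smul_smul,
      mul_inv_cancel₀ hν, one_smul] at e
    rw [← e]; abel

end AbstractForms

/-! ### Sets of reals with finite initial segments. -/

section Enumeration

theorem Set.countable_of_finite_inter_Iic {S : Set ℝ} (hS : ∀ C, (S ∩ Iic C).Finite) :
    S.Countable := by
  have : S = ⋃ n : ℕ, S ∩ Iic (n : ℝ) := by
    ext x
    simp only [mem_iUnion, mem_inter_iff, mem_Iic]
    exact ⟨fun hx => (exists_nat_ge x).imp fun n hn => ⟨hx, hn⟩, fun ⟨_, hx, _⟩ => hx⟩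
  rw [this]
  exact countable_iUnion fun n => (hS n).countable

/-- An infinite set of reals with finite initial segments is the range of a monotone sequence that
tends to infinity. -/
theorem Set.Infinite.exists_monotone_range_eq {S : Set ℝ} (hS : ∀ C, (S ∩ Iic C).Finite)
    (hinf : S.Infinite) :
    ∃ l : ℕ → ℝ, Monotone l ∧ range l = S ∧ Tendsto l atTop atTop := by
  classical
  -- Counting the smaller elements embeds `S` in `ℕ` strictly monotonically, and an infinite subset
  -- of `ℕ` is order isomorphic to `ℕ`.
  let e : S → ℕ := fun x => (S ∩ Iio (x : ℝ)).ncard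
  have hfin : ∀ x, (S ∩ Iio x).Finite := fun x =>
    (hS x).subset (inter_subset_inter_right _ Iio_subset_Iic_self)
  have he : StrictMono e := fun x y hxy => by
    refine Set.ncard_lt_ncard ⟨fun z hz => ⟨hz.1, lt_trans (mem_Iio.1 hz.2) hxy⟩, fun hsub => ?_⟩ (hfin _)
    exact lt_irrefl (x : ℝ) (mem_Iio.1 (hsub ⟨x.2, hxy⟩).2)
  have : Infinite S := hinf.to_subtype
  have : Infinite (range e) := (Set.infinite_range_of_injective he.injective).to_subtype
  let φ := Nat.Subtype.orderIsoOfNat (range e)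
  have hφ : ∀ n, ∃ x : S, e x = φ n := fun n => (φ n).2
  choose l hl using hφ
  have hmono : Monotone fun n => (l n : ℝ) := fun n k hnk => by
    have h1 : e (l n) ≤ e (l k) := by
      rw [hl, hl]; exact φ.monotone hnk
    exact he.le_iff_le.1 h1
  have hrange : range (fun n => (l n : ℝ)) = S := by
    ext x
    refine ⟨?_, fun hx => ?_⟩
    · rintro ⟨n, rfl⟩; exact (l n).2
    · refine ⟨φ.symm ⟨e ⟨x, hx⟩, mem_range_self _⟩, ?_⟩
      have : l (φ.symm ⟨e ⟨x, hx⟩, mem_range_self _⟩) = ⟨x, hx⟩ :=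
        he.injective (by rw [hl]; simp)
      simp only [this]
  refine ⟨fun n => l n, hmono, hrange, tendsto_atTop_atTop_of_monotone hmono fun C => ?_⟩
  by_contra! hC
  refine hinf ((hS C).subset fun x hx => ⟨hx, ?_⟩)
  rw [← hrange] at hx
  obtain ⟨n, rfl⟩ := hx
  exact (hC n).le

end Enumeration

/-! ### A real trigonometric Hilbert basis indexed by the integers. -/

namespace PeriodicFractional

/-- The normalised trigonometric function `(cos + sin) (2 π n x / T) / √T`. -/
noncomputable def trig (T : ℝ) (n : ℤ) (x : ℝ) : ℝ :=
  (Real.cos (2 * Real.pi * n / T * x) + Real.sin (2 * Real.pi * n / T * x)) / √T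

theorem contDiff_trig (T : ℝ) (n : ℤ) : ContDiff ℝ ∞ (trig T n) := by
  unfold trig; fun_prop

theorem continuous_trig (T : ℝ) (n : ℤ) : Continuous (trig T n) := (contDiff_trig T n).continuous

/-- Since `(cos + sin)' = cos - sin`, differentiation exchanges the frequencies `n` and `-n`, so the
family is closed under it up to scalars. -/
theorem hasDerivAt_trig (T : ℝ) (n : ℤ) (x : ℝ) :
    HasDerivAt (trig T n) (2 * Real.pi * n / T * trig T (-n) x) x := by
  have h1 : HasDerivAt (fun x : ℝ => 2 * Real.pi * n / T * x) (2 * Real.pi * n / T) x := by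
    simpa using (hasDerivAt_id x).const_mul (2 * Real.pi * n / T)
  have h2 := (h1.cos.add h1.sin).div_const (√T)
  refine h2.congr_deriv ?_
  have : 2 * Real.pi * ((-n : ℤ) : ℝ) / T * x = -(2 * Real.pi * n / T * x) := by push_cast; ring
  rw [trig, this, Real.cos_neg, Real.sin_neg]
  ring

theorem trig_periodic {T : ℝ} (hT : 0 < T) (n : ℤ) : Function.Periodic (trig T n) T := fun x => by
  have : 2 * Real.pi * n / T * (x + T) = 2 * Real.pi * n / T * x + n * (2 * Real.pi) := by
    field_simp
  simp only [trig, this, Real.cos_add_int_mul_two_pi, Real.sin_add_int_mul_two_pi]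

theorem abs_trig_le (T : ℝ) (n : ℤ) (x : ℝ) : |trig T n x| ≤ 2 / √T := by
  rw [trig, abs_div, abs_of_nonneg (Real.sqrt_nonneg T)]
  gcongr
  refine (abs_add_le _ _).trans ?_
  linarith [Real.abs_cos_le_one (2 * Real.pi * n / T * x),
    Real.abs_sin_le_one (2 * Real.pi * n / T * x)]

instance (T : ℝ) : IsFiniteMeasure (volume.restrict (period T)) := by
  unfold period; infer_instance

theorem measurableSet_period (T : ℝ) : MeasurableSet (period T) := measurableSet_Ioc

theorem integral_period {T : ℝ} (hT : 0 < T) {E : Type*} [NormedAddCommGroup E] [NormedSpace ℝ E]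
    (f : ℝ → E) : ∫ x in period T, f x = ∫ x in (-(T / 2))..(T / 2), f x := by
  rw [intervalIntegral.integral_of_le (by linarith), period]

theorem memLp_trig (T : ℝ) (n : ℤ) : MemLp (trig T n) 2 (volume.restrict (period T)) :=
  MemLp.of_bound (continuous_trig T n).aestronglyMeasurable (2 / √T)
    (ae_of_all _ fun x => abs_trig_le T n x)

theorem integral_cos_period {T : ℝ} (hT : 0 < T) (k : ℤ) :
    ∫ x in (-(T / 2))..(T / 2), Real.cos (2 * Real.pi * k / T * x) = if k = 0 then T else 0 := by
  split_ifs with hk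
  · simp [hk]
  · have hc : 2 * Real.pi * k / T ≠ 0 := by
      have : (k : ℝ) ≠ 0 := by exact_mod_cast hk
      positivity
    rw [intervalIntegral.integral_comp_mul_left (fun x => Real.cos x) hc, integral_cos]
    have h1 : 2 * Real.pi * k / T * (T / 2) = k * Real.pi := by field_simp
    have h2 : 2 * Real.pi * k / T * -(T / 2) = -(k * Real.pi) := by field_simp
    rw [h1, h2, Real.sin_neg, Real.sin_int_mul_pi]; simp

theorem integral_sin_period {T : ℝ} (hT : 0 < T) (k : ℤ) :
    ∫ x in (-(T / 2))..(T / 2), Real.sin (2 * Real.pi * k / T * x) = 0 := by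
  by_cases hk : k = 0
  · simp [hk]
  · have hc : 2 * Real.pi * k / T ≠ 0 := by
      have : (k : ℝ) ≠ 0 := by exact_mod_cast hk
      positivity
    rw [intervalIntegral.integral_comp_mul_left (fun x => Real.sin x) hc, integral_sin]
    have h1 : 2 * Real.pi * k / T * (T / 2) = k * Real.pi := by field_simp
    have h2 : 2 * Real.pi * k / T * -(T / 2) = -(k * Real.pi) := by field_simp
    rw [h1, h2, Real.cos_neg]; simp

/-- The product `(cos a + sin a)(cos b + sin b)` equals `cos (a - b) + sin (a + b)`. The sine always
integrates to zero, and the cosine does so unless `n = m`. -/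
theorem integral_trig_mul_trig {T : ℝ} (hT : 0 < T) (n m : ℤ) :
    ∫ x in period T, trig T n x * trig T m x = if n = m then 1 else 0 := by
  have h1 : ∀ x, trig T n x * trig T m x = (Real.cos (2 * Real.pi * ((n - m : ℤ) : ℝ) / T * x) +
      Real.sin (2 * Real.pi * ((n + m : ℤ) : ℝ) / T * x)) / T := fun x => by
    have e1 : 2 * Real.pi * ((n - m : ℤ) : ℝ) / T * x =
      2 * Real.pi * n / T * x - 2 * Real.pi * m / T * x := by push_cast; ring
    have e2 : 2 * Real.pi * ((n + m : ℤ) : ℝ) / T * x =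
      2 * Real.pi * n / T * x + 2 * Real.pi * m / T * x := by push_cast; ring
    rw [e1, e2, Real.cos_sub, Real.sin_add, trig, trig, div_mul_div_comm, Real.mul_self_sqrt hT.le]
    ring
  simp only [h1]
  rw [integral_period hT, intervalIntegral.integral_div, intervalIntegral.integral_add,
    integral_cos_period hT, integral_sin_period hT]
  · by_cases h : n = m
    · simp [h, hT.ne']
    · simp [h, sub_eq_zero]
  · exact Continuous.intervalIntegrable (by fun_prop) _ _
  · exact Continuous.intervalIntegrable (by fun_prop) _ _

/-- Half sums and differences over `±n` isolate the cosine and sine moments, so every complex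
Fourier coefficient vanishes, and Parseval's identity gives `∫ f² = 0`. -/
theorem ae_eq_zero_of_integral_trig_eq_zero {T : ℝ} (hT : 0 < T) {f : ℝ → ℝ}
    (hf : MemLp f 2 (volume.restrict (period T)))
    (h : ∀ n, ∫ x in period T, trig T n x * f x = 0) : f =ᵐ[volume.restrict (period T)] 0 := by
  have hab : -(T / 2) < T / 2 := by linarith
  have hsT : √T ≠ 0 := (Real.sqrt_pos.2 hT).ne'
  have hint : ∀ n, Integrable (fun x => trig T n x * f x) (volume.restrict (period T)) :=
    fun n => (memLp_trig T n).integrable_mul hf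
  have hcos : ∀ n : ℤ, ∫ x in period T, Real.cos (2 * Real.pi * n / T * x) * f x = 0 := fun n => by
    have e : ∀ x, Real.cos (2 * Real.pi * n / T * x) * f x =
        √T / 2 * (trig T n x * f x + trig T (-n) x * f x) := fun x => by
      have : 2 * Real.pi * ((-n : ℤ) : ℝ) / T * x = -(2 * Real.pi * n / T * x) := by
        push_cast; ring
      rw [trig, trig, this, Real.cos_neg, Real.sin_neg]; field_simp; ring
    simp only [e]
    rw [integral_const_mul, integral_add (hint _) (hint _), h, h]; simp
  have hsin : ∀ n : ℤ, ∫ x in period T, Real.sin (2 * Real.pi * n / T * x) * f x = 0 := fun n => by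
    have e : ∀ x, Real.sin (2 * Real.pi * n / T * x) * f x =
        √T / 2 * (trig T n x * f x - trig T (-n) x * f x) := fun x => by
      have : 2 * Real.pi * ((-n : ℤ) : ℝ) / T * x = -(2 * Real.pi * n / T * x) := by
        push_cast; ring
      rw [trig, trig, this, Real.cos_neg, Real.sin_neg]; field_simp; ring
    simp only [e]
    rw [integral_const_mul, integral_sub (hint _) (hint _), h, h]; simp
  have hfC : MemLp (fun x => (f x : ℂ)) 2 (volume.restrict (period T)) := hf.ofReal
  have hP := hasSum_sq_fourierCoeffOn hab hfC
  have hf1 : Integrable f (volume.restrict (period T)) := hf.integrable one_le_two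
  have hcoef : ∀ n, fourierCoeffOn hab (fun x => (f x : ℂ)) n = 0 := fun n => by
    rw [fourierCoeffOn_eq_integral, ← integral_period hT]
    have e : ∀ x : ℝ, fourier (-n) (x : AddCircle (T / 2 - -(T / 2))) • (f x : ℂ) =
        ((Real.cos (2 * Real.pi * n / T * x) * f x : ℝ) : ℂ) -
          Complex.I * ((Real.sin (2 * Real.pi * n / T * x) * f x : ℝ) : ℂ) := fun x => by
      rw [fourier_coe_apply, smul_eq_mul]
      have : 2 * (Real.pi : ℂ) * Complex.I * ((-n : ℤ) : ℂ) * x / ((T / 2 - -(T / 2) : ℝ) : ℂ) =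
          ((-(2 * Real.pi * n / T * x) : ℝ) : ℂ) * Complex.I := by
        rw [sub_neg_eq_add, add_halves]; push_cast; ring
      rw [this, Complex.exp_mul_I, ← Complex.ofReal_cos, ← Complex.ofReal_sin, Real.cos_neg,
        Real.sin_neg]
      push_cast; ring
    have i1 : Integrable (fun x => Real.cos (2 * Real.pi * n / T * x) * f x)
        (volume.restrict (period T)) :=
      hf1.bdd_mul (c := 1) (Continuous.aestronglyMeasurable (by fun_prop))
        (ae_of_all _ fun x => Real.abs_cos_le_one _)
    have i2 : Integrable (fun x => Real.sin (2 * Real.pi * n / T * x) * f x)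
        (volume.restrict (period T)) :=
      hf1.bdd_mul (c := 1) (Continuous.aestronglyMeasurable (by fun_prop))
        (ae_of_all _ fun x => Real.abs_sin_le_one _)
    simp only [e]
    rw [integral_sub i1.ofReal (i2.ofReal.const_mul _), integral_const_mul, integral_complex_ofReal,
      integral_complex_ofReal, hcos, hsin]
    simp
  simp only [hcoef, norm_zero, ne_eq, OfNat.ofNat_ne_zero, not_false_eq_true, zero_pow] at hP
  have h0 := hP.unique hasSum_zero
  rw [← integral_period hT, smul_eq_zero] at h0
  replace h0 := h0.resolve_left (inv_ne_zero (by linarith))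
  rw [integral_eq_zero_iff_of_nonneg (fun x => by positivity)
    ((memLp_two_iff_integrable_sq_norm hfC.1).1 hfC)] at h0
  filter_upwards [h0] with x hx
  simpa using hx

theorem orthonormal_trig {T : ℝ} (hT : 0 < T) :
    Orthonormal ℝ fun n => (memLp_trig T n).toLp := by
  rw [orthonormal_iff_ite]
  intro n m
  rw [← integral_trig_mul_trig hT n m, L2.inner_def]
  refine integral_congr_ae ?_
  filter_upwards [(memLp_trig T n).coeFn_toLp, (memLp_trig T m).coeFn_toLp] with x h1 h2
  rw [h1, h2]; simp [mul_comm]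

/-- The Hilbert basis `trig T n`, `n : ℤ`, of the real `L²` space of a period. -/
noncomputable def trigBasis {T : ℝ} (hT : 0 < T) :
    HilbertBasis ℤ ℝ (Lp ℝ 2 (volume.restrict (period T))) :=
  HilbertBasis.mkOfOrthogonalEqBot (orthonormal_trig hT) <| by
    refine (Submodule.eq_bot_iff _).2 fun f hf => ?_
    rw [Submodule.mem_orthogonal] at hf
    refine (Lp.eq_zero_iff_ae_eq_zero).2
      (ae_eq_zero_of_integral_trig_eq_zero hT (Lp.memLp f) fun n => ?_)
    rw [← hf _ (Submodule.subset_span ⟨n, rfl⟩), L2.inner_def]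
    refine integral_congr_ae ?_
    filter_upwards [(memLp_trig T n).coeFn_toLp] with x h1
    rw [h1]; simp [mul_comm]

theorem trigBasis_apply {T : ℝ} (hT : 0 < T) (n : ℤ) :
    trigBasis hT n = (memLp_trig T n).toLp := by
  simp [trigBasis, HilbertBasis.coe_mkOfOrthogonalEqBot]

/-! ### The weighted measure and its duality with unweighted integrals. -/

section Weight

theorem measurableSet_strip (T : ℝ) : MeasurableSet (strip T) :=
  (measurableSet_period T).prod measurableSet_Ioi

theorem restrict_strip (T : ℝ) : (volume : Measure (ℝ × ℝ)).restrict (strip T) =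
    (volume.restrict (period T)).prod (volume.restrict (Ioi 0)) := by
  rw [Measure.prod_restrict]; rfl

theorem measurable_weight_density (s : ℝ) :
    Measurable fun p : ℝ × ℝ => ENNReal.ofReal (p.2 ^ (1 - 2 * s)) := by fun_prop

theorem integral_weight (s T : ℝ) (f : ℝ × ℝ → ℝ) :
    ∫ p, f p ∂weight s T = ∫ p in strip T, p.2 ^ (1 - 2 * s) * f p := by
  rw [weight, integral_withDensity_eq_integral_toReal_smul (measurable_weight_density s)
    (ae_of_all _ fun p => ENNReal.ofReal_lt_top)]
  refine setIntegral_congr_fun (measurableSet_strip T) fun p hp => ?_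
  have : (0 : ℝ) < p.2 := hp.2
  simp only [smul_eq_mul]
  rw [ENNReal.toReal_ofReal (by positivity)]

theorem integrable_weight_iff (s T : ℝ) (f : ℝ × ℝ → ℝ) :
    Integrable f (weight s T) ↔ IntegrableOn (fun p => p.2 ^ (1 - 2 * s) * f p) (strip T) := by
  rw [weight, integrable_withDensity_iff_integrable_smul' (measurable_weight_density s)
    (ae_of_all _ fun p => ENNReal.ofReal_lt_top)]
  refine integrableOn_congr_fun (fun p hp => ?_) (measurableSet_strip T)
  have : (0 : ℝ) < p.2 := hp.2
  simp only [smul_eq_mul]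
  rw [ENNReal.toReal_ofReal (by positivity)]

theorem absolutelyContinuous_weight (s T : ℝ) : volume.restrict (strip T) ≪ weight s T := by
  refine withDensity_absolutelyContinuous' (measurable_weight_density s).aemeasurable ?_
  refine (ae_restrict_iff' (measurableSet_strip T)).2 (ae_of_all _ fun p hp => ?_)
  have : (0 : ℝ) < p.2 := hp.2
  exact (ENNReal.ofReal_pos.2 (by positivity)).ne'

/-- `y ^ (2 s - 1) φ`, the function that represents integration against `φ` on the strip in the
weighted `L²` space. -/
noncomputable def stripDual (s : ℝ) (φ : ℝ × ℝ → ℝ) (p : ℝ × ℝ) : ℝ := p.2 ^ (2 * s - 1) * φ p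

theorem weight_mul_stripDual {s T : ℝ} (φ : ℝ × ℝ → ℝ) {p : ℝ × ℝ} (hp : p ∈ strip T) :
    p.2 ^ (1 - 2 * s) * stripDual s φ p = φ p := by
  have h : (0 : ℝ) < p.2 := hp.2
  rw [stripDual, ← mul_assoc, ← Real.rpow_add h]; simp

theorem integral_mul_stripDual (s T : ℝ) (P φ : ℝ × ℝ → ℝ) :
    ∫ p, P p * stripDual s φ p ∂weight s T = ∫ p in strip T, P p * φ p := by
  rw [integral_weight]
  refine setIntegral_congr_fun (measurableSet_strip T) fun p hp => ?_
  rw [mul_left_comm, weight_mul_stripDual φ hp]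

theorem integrable_mul_stripDual_iff (s T : ℝ) (P φ : ℝ × ℝ → ℝ) :
    Integrable (fun p => P p * stripDual s φ p) (weight s T) ↔
      IntegrableOn (fun p => P p * φ p) (strip T) := by
  rw [integrable_weight_iff]
  refine integrableOn_congr_fun (fun p hp => ?_) (measurableSet_strip T)
  rw [mul_left_comm, weight_mul_stripDual φ hp]

theorem integral_stripDual_mul_stripDual (s T : ℝ) (φ ψ : ℝ × ℝ → ℝ) :
    ∫ p, stripDual s φ p * stripDual s ψ p ∂weight s T =
      ∫ p in strip T, p.2 ^ (2 * s - 1) * (φ p * ψ p) := by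
  rw [integral_mul_stripDual]
  simp only [stripDual, mul_assoc]

variable {s T : ℝ}

theorem integrableOn_rpow (hs : 0 < s) {R : ℝ} (hR : 0 ≤ R) :
    IntegrableOn (fun y : ℝ => y ^ (2 * s - 1)) (Ioc 0 R) := by
  rw [← intervalIntegrable_iff_integrableOn_Ioc_of_le hR]
  exact intervalIntegral.intervalIntegrable_rpow' (by linarith)

theorem integrable_indicator_rpow (hs : 0 < s) {R : ℝ} (hR : 0 ≤ R) (T : ℝ) :
    Integrable (fun p : ℝ × ℝ => (1 : ℝ) * (Ioc 0 R).indicator (fun y => y ^ (2 * s - 1)) p.2)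
      (volume.restrict (strip T)) := by
  rw [restrict_strip]
  refine Integrable.mul_prod (f := fun _ => (1 : ℝ)) (integrable_const 1) ?_
  exact ((integrable_indicator_iff measurableSet_Ioc).2 (integrableOn_rpow hs hR)).restrict

theorem integral_indicator_rpow (hs : 0 < s) (hT : 0 < T) {R : ℝ} (hR : 0 ≤ R) :
    ∫ p in strip T, (1 : ℝ) * (Ioc 0 R).indicator (fun y => y ^ (2 * s - 1)) p.2 =
      T * (R ^ (2 * s) / (2 * s)) := by
  rw [restrict_strip, integral_prod_mul (f := fun _ => (1 : ℝ))]
  congr 1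
  · simp [period, hT.le]
  · rw [setIntegral_indicator measurableSet_Ioc,
      inter_eq_self_of_subset_right Ioc_subset_Ioi_self, ← intervalIntegral.integral_of_le hR,
      integral_rpow (Or.inl (by linarith))]
    rw [Real.zero_rpow (by linarith)]
    simp

theorem stripDual_sq_le {φ : ℝ × ℝ → ℝ} {M R : ℝ} (hM : ∀ p ∈ strip T, |φ p| ≤ M)
    (hφ : ∀ p : ℝ × ℝ, R < p.2 → φ p = 0) {p : ℝ × ℝ} (hp : p ∈ strip T) :
    p.2 ^ (2 * s - 1) * (φ p * φ p) ≤
      M ^ 2 * (1 * (Ioc 0 R).indicator (fun y => y ^ (2 * s - 1)) p.2) := by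
  have h0 : (0 : ℝ) < p.2 := hp.2
  rcases le_or_gt p.2 R with h | h
  · rw [indicator_of_mem (mem_Ioc.2 ⟨h0, h⟩), one_mul, mul_comm]
    have : φ p * φ p ≤ M ^ 2 := by
      rw [← sq, ← sq_abs]; exact pow_le_pow_left₀ (abs_nonneg _) (hM p hp) 2
    gcongr
  · rw [hφ p h, indicator_of_notMem (fun h' => absurd h'.2 (not_le.2 h))]; simp

/-- The weighted square norm is `∫ y^(2s-1) φ²`, finite for bounded `φ` vanishing at large height
because `2s - 1 > -1`. -/
theorem memLp_stripDual (hs : 0 < s) {φ : ℝ × ℝ → ℝ} (hφm : Measurable φ) {M R : ℝ} (hR : 0 ≤ R)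
    (hM : ∀ p ∈ strip T, |φ p| ≤ M) (hφ : ∀ p : ℝ × ℝ, R < p.2 → φ p = 0) :
    MemLp (stripDual s φ) 2 (weight s T) := by
  have hm : Measurable (stripDual s φ) := by unfold stripDual; fun_prop
  rw [memLp_two_iff_integrable_sq hm.aestronglyMeasurable]
  simp only [sq]
  rw [integrable_mul_stripDual_iff]
  refine ((integrable_indicator_rpow hs hR T).const_mul (M ^ 2)).mono'
    (by fun_prop) ?_
  refine (ae_restrict_iff' (measurableSet_strip T)).2 (ae_of_all _ fun p hp => ?_)
  have h0 : (0 : ℝ) < p.2 := hp.2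
  rw [stripDual, mul_assoc, Real.norm_of_nonneg
    (mul_nonneg (by positivity) (mul_self_nonneg _))]
  exact stripDual_sq_le hM hφ hp

theorem norm_stripDual_toLp_sq_le (hs : 0 < s) (hT : 0 < T) {φ : ℝ × ℝ → ℝ}
    {M R : ℝ} (hR : 0 ≤ R) (hM : ∀ p ∈ strip T, |φ p| ≤ M)
    (hφ : ∀ p : ℝ × ℝ, R < p.2 → φ p = 0) (hL : MemLp (stripDual s φ) 2 (weight s T)) :
    ‖hL.toLp‖ ^ 2 ≤ M ^ 2 * (T * (R ^ (2 * s) / (2 * s))) := by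
  have e : ‖hL.toLp‖ ^ 2 = ∫ p, stripDual s φ p * stripDual s φ p ∂weight s T := by
    rw [← real_inner_self_eq_norm_sq, L2.inner_def]
    refine integral_congr_ae ?_
    filter_upwards [hL.coeFn_toLp] with p hp
    rw [hp]; simp [sq]
  rw [e, integral_stripDual_mul_stripDual, ← integral_indicator_rpow hs hT hR,
    ← integral_const_mul]
  refine setIntegral_mono_on ?_ ((integrable_indicator_rpow hs hR T).const_mul (M ^ 2))
    (measurableSet_strip T) fun p hp => stripDual_sq_le hM hφ hp
  have := (memLp_two_iff_integrable_sq hL.1).1 hL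
  simp only [sq] at this
  rw [integrable_mul_stripDual_iff] at this
  simpa only [stripDual, mul_assoc] using this

end Weight

/-! ### Test functions: derivatives and bounds. -/

section Tests

variable {s T : ℝ} {φ : ℝ × ℝ → ℝ}

theorem IsTest.continuous (h : IsTest T φ) : Continuous φ := h.smooth.continuous

theorem IsTest.differentiable (h : IsTest T φ) : Differentiable ℝ φ :=
  h.smooth.differentiable (by simp)

theorem IsTest.fderiv_apply (h : IsTest T φ) (v : ℝ × ℝ) :
    IsTest T fun p => fderiv ℝ φ p v where
  smooth := (h.smooth.fderiv_right (by simp)).clm_apply contDiff_const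
  periodic x y := by
    have : (fun p : ℝ × ℝ => φ (p + (T, 0))) = φ := by
      ext ⟨x, y⟩; simpa using h.periodic x y
    have h2 := fderiv_comp_add_right (𝕜 := ℝ) (f := φ) (x := (x, y)) (T, 0)
    rw [this] at h2
    simp [h2]
  support := by
    obtain ⟨R, hR⟩ := h.support
    refine ⟨R + 1, fun x y hy => ?_⟩
    have : φ =ᶠ[𝓝 (x, y)] fun _ => 0 := by
      have ho : IsOpen {p : ℝ × ℝ | R < |p.2|} :=
        isOpen_lt continuous_const (by fun_prop)
      filter_upwards [ho.mem_nhds (by change R < |y|; linarith : (x, y) ∈ {p : ℝ × ℝ | R < |p.2|})]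
        with p hp
      exact hR p.1 p.2 (le_of_lt hp)
    rw [this.fderiv_eq]; simp

theorem IsTest.fderiv_fderiv_comm (h : IsTest T φ) (p v w : ℝ × ℝ) :
    fderiv ℝ (fun q => fderiv ℝ φ q v) p w = fderiv ℝ (fun q => fderiv ℝ φ q w) p v := by
  have h1 : DifferentiableAt ℝ (fderiv ℝ φ) p :=
    ((h.smooth.fderiv_right (m := 1) (WithTop.coe_le_coe.2 (le_top : (1 + 1 : ℕ∞) ≤ ⊤))).differentiable (by simp)) p
  have h2 : IsSymmSndFDerivAt ℝ φ p :=
    h.smooth.contDiffAt.isSymmSndFDerivAt (by simpa using WithTop.coe_le_coe.2 (le_top : (2 : ℕ∞) ≤ ⊤))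
  have e : ∀ v, fderiv ℝ (fun q => fderiv ℝ φ q v) p = (fderiv ℝ (fderiv ℝ φ) p).flip v := by
    intro v
    rw [fderiv_clm_apply h1 (by fun_prop)]
    simp
  rw [e, e]
  exact h2 w v

theorem IsTest.exists_bound (h : IsTest T φ) :
    ∃ M R : ℝ, 0 < R ∧ (∀ x ∈ period T, ∀ y, |φ (x, y)| ≤ M) ∧
      ∀ x y, R ≤ |y| → φ (x, y) = 0 := by
  obtain ⟨R, hR⟩ := h.support
  obtain ⟨M, hM⟩ := ((isCompact_Icc (a := -(T / 2)) (b := T / 2)).prod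
    (isCompact_Icc (a := -R) (b := R))).exists_bound_of_continuousOn h.continuous.continuousOn
  refine ⟨max M 0, max R 1, by positivity, fun x hx y => ?_, fun x y hy =>
    hR x y ((le_max_left _ _).trans hy)⟩
  rcases le_or_gt R |y| with h1 | h1
  · rw [hR x y h1]; simp
  · exact (hM (x, y) ⟨⟨hx.1.le, hx.2⟩, (abs_le.1 h1.le).1, (abs_le.1 h1.le).2⟩).trans
      (le_max_left _ _)

theorem IsTest.memLp_trace (h : IsTest T φ) :
    MemLp (fun x => φ (x, 0)) 2 (volume.restrict (period T)) := by
  obtain ⟨M, R, -, hM, -⟩ := h.exists_bound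
  refine MemLp.of_bound (h.continuous.comp (by fun_prop)).aestronglyMeasurable M ?_
  exact (ae_restrict_iff' (measurableSet_period T)).2 (ae_of_all _ fun x hx => hM x hx 0)

theorem IsTest.memLp_stripDual (h : IsTest T φ) (hs : 0 < s) :
    MemLp (stripDual s φ) 2 (weight s T) := by
  obtain ⟨M, R, hR, hM, h0⟩ := h.exists_bound
  exact PeriodicFractional.memLp_stripDual hs h.continuous.measurable hR.le
    (fun p hp => hM p.1 hp.1 p.2) fun p hp => h0 p.1 p.2 (hp.le.trans (le_abs_self _))

end Tests

/-! ### The energy space as a closed space of traces and gradients. -/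

section EnergySpace

/-- The real `L²` space of a period. -/
noncomputable abbrev TraceSpace (T : ℝ) := Lp ℝ 2 (volume.restrict (period T))

/-- The weighted `L²` space of the strip. -/
noncomputable abbrev GradSpace (s T : ℝ) := Lp ℝ 2 (weight s T)

/-- Triples of a boundary function and the two components of a vector field. -/
noncomputable abbrev Triple (s T : ℝ) := WithLp 2 (TraceSpace T × WithLp 2 (GradSpace s T × GradSpace s T))

variable {s T : ℝ}

theorem inner_toLp_eq_integral {α : Type*} [MeasurableSpace α] {μ : Measure α} {g : α → ℝ}
    (hg : MemLp g 2 μ) (f : Lp ℝ 2 μ) : ⟪hg.toLp, f⟫_ℝ = ∫ x, f x * g x ∂μ := by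
  rw [L2.inner_def]
  refine integral_congr_ae ?_
  filter_upwards [hg.coeFn_toLp] with x hx
  rw [hx]; simp

theorem inner_stripDual_toLp {φ : ℝ × ℝ → ℝ} (hφ : MemLp (stripDual s φ) 2 (weight s T))
    (f : GradSpace s T) : ⟪hφ.toLp, f⟫_ℝ = ∫ p in strip T, f p * φ p := by
  rw [inner_toLp_eq_integral, integral_mul_stripDual]

/-- The triple orthogonal to `(u, P, Q)` exactly if `(P, Q)` is weakly curl free and has tangential
boundary values `u'`, both tested against `Φ`. -/
noncomputable def curlConstraint (hs : 0 < s) {Φ : ℝ × ℝ → ℝ} (hΦ : IsTest T Φ) : Triple s T :=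
  WithLp.toLp 2 ((hΦ.fderiv_apply (1, 0)).memLp_trace.toLp,
    WithLp.toLp 2 (-((hΦ.fderiv_apply (0, 1)).memLp_stripDual hs).toLp,
      ((hΦ.fderiv_apply (1, 0)).memLp_stripDual hs).toLp))

/-- The Hilbert space of triples of the trace and the two components of the gradient of a function
of finite energy. -/
noncomputable def energySubmodule (s T : ℝ) (hs : 0 < s) : Submodule ℝ (Triple s T) :=
  (Submodule.span ℝ (range fun Φ : {Φ // IsTest T Φ} => curlConstraint hs Φ.2))ᗮ

/-- The constraint mentions only the trace and the gradient. Written as orthogonality to fixed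
vectors, it defines a closed subspace, whence completeness. -/
theorem mem_energySubmodule_iff (hs : 0 < s) (x : Triple s T) :
    x ∈ energySubmodule s T hs ↔ ∀ Φ, IsTest T Φ →
      (∫ t in period T, x.fst t * fderiv ℝ Φ (t, 0) (1, 0)) +
        ∫ p in strip T, x.snd.snd p * fderiv ℝ Φ p (1, 0) =
      ∫ p in strip T, x.snd.fst p * fderiv ℝ Φ p (0, 1) := by
  have key : ∀ Φ (hΦ : IsTest T Φ), ⟪curlConstraint hs hΦ, x⟫_ℝ =
      (∫ t in period T, x.fst t * fderiv ℝ Φ (t, 0) (1, 0)) +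
        (-(∫ p in strip T, x.snd.fst p * fderiv ℝ Φ p (0, 1)) +
        ∫ p in strip T, x.snd.snd p * fderiv ℝ Φ p (1, 0)) := fun Φ hΦ => by
    rw [← inner_stripDual_toLp ((hΦ.fderiv_apply (1, 0)).memLp_stripDual hs),
      ← inner_stripDual_toLp ((hΦ.fderiv_apply (0, 1)).memLp_stripDual hs),
      ← inner_toLp_eq_integral (hΦ.fderiv_apply (1, 0)).memLp_trace, ← inner_neg_left]
    rfl
  constructor
  · intro hx Φ hΦ
    have := (Submodule.mem_orthogonal _ _).1 hx _ (Submodule.subset_span ⟨⟨Φ, hΦ⟩, rfl⟩)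
    simp only at this
    rw [key] at this
    linarith
  · intro h
    rw [energySubmodule, Submodule.mem_orthogonal]
    intro v hv
    induction hv using Submodule.span_induction with
    | mem v hv =>
      obtain ⟨⟨Φ, hΦ⟩, rfl⟩ := hv
      simp only
      rw [key]
      linarith [h Φ hΦ]
    | zero => simp
    | add v w _ _ h1 h2 => rw [inner_add_left, h1, h2, add_zero]
    | smul c v _ h1 => rw [real_inner_smul_left, h1, mul_zero]

/-- The Hilbert space of functions of finite energy. -/
def EnergySpace (s T : ℝ) (hs : 0 < s) : Type := energySubmodule s T hs

namespace EnergySpace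

noncomputable instance (hs : 0 < s) : NormedAddCommGroup (EnergySpace s T hs) :=
  inferInstanceAs (NormedAddCommGroup (energySubmodule s T hs))

noncomputable instance (hs : 0 < s) : InnerProductSpace ℝ (EnergySpace s T hs) :=
  inferInstanceAs (InnerProductSpace ℝ (energySubmodule s T hs))

instance (hs : 0 < s) : CompleteSpace (EnergySpace s T hs) := by
  change CompleteSpace (energySubmodule s T hs)
  unfold energySubmodule; infer_instance

variable {hs : 0 < s}

/-- The triple underlying an element of the energy space. -/
def toTriple (h : EnergySpace s T hs) : Triple s T := Subtype.val h

theorem toTriple_mem (h : EnergySpace s T hs) : h.toTriple ∈ energySubmodule s T hs := Subtype.property h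

theorem norm_toTriple (h : EnergySpace s T hs) : ‖h.toTriple‖ = ‖h‖ := rfl

theorem toTriple_injective : Function.Injective (toTriple : EnergySpace s T hs → Triple s T) :=
  Subtype.val_injective

/-- The inclusion of the energy space into the space of triples. -/
noncomputable def inclusion (hs : 0 < s) : EnergySpace s T hs →L[ℝ] Triple s T :=
  (energySubmodule s T hs).subtypeL

end EnergySpace

variable {U P Q : ℝ × ℝ → ℝ}

/-- The triple of the trace and the weak gradient of a function of finite energy. -/
noncomputable def MemEnergy.toTriple (h : MemEnergy s T U P Q) : Triple s T :=
  WithLp.toLp 2 (h.trace_mem.memLp.toLp, WithLp.toLp 2 (h.memLp_dx.toLp, h.memLp_dy.toLp))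

theorem ae_strip_of_ae_weight {p : ℝ × ℝ → Prop} (h : ∀ᵐ z ∂weight s T, p z) :
    ∀ᵐ z ∂volume.restrict (strip T), p z := absolutelyContinuous_weight s T h

/-- Use `∂Φ/∂y` as test function in the horizontal formula and `∂Φ/∂x` in the vertical one. The
mixed second derivatives agree, so the terms containing `U` cancel. -/
theorem MemEnergy.toTriple_mem (h : MemEnergy s T U P Q) (hs : 0 < s) :
    h.toTriple ∈ energySubmodule s T hs := by
  rw [mem_energySubmodule_iff]
  intro Φ hΦ
  have h1 := h.weak_dx _ (hΦ.fderiv_apply (0, 1))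
  have h2 := h.weak_dy _ (hΦ.fderiv_apply (1, 0))
  simp only [hΦ.fderiv_fderiv_comm _ (1, 0) (0, 1)] at h2
  rw [h1] at h2
  have e1 : ∫ t in period T, h.toTriple.fst t * fderiv ℝ Φ (t, 0) (1, 0) =
      ∫ t in period T, U (t, 0) * fderiv ℝ Φ (t, 0) (1, 0) := by
    refine integral_congr_ae ?_
    filter_upwards [h.trace_mem.memLp.coeFn_toLp] with t ht
    exact congrArg (· * _) ht
  have e2 : ∫ p in strip T, h.toTriple.snd.snd p * fderiv ℝ Φ p (1, 0) =
      ∫ p in strip T, Q p * fderiv ℝ Φ p (1, 0) := by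
    refine integral_congr_ae ?_
    filter_upwards [ae_strip_of_ae_weight h.memLp_dy.coeFn_toLp] with t ht
    exact congrArg (· * _) ht
  have e3 : ∫ p in strip T, h.toTriple.snd.fst p * fderiv ℝ Φ p (0, 1) =
      ∫ p in strip T, P p * fderiv ℝ Φ p (0, 1) := by
    refine integral_congr_ae ?_
    filter_upwards [ae_strip_of_ae_weight h.memLp_dx.coeFn_toLp] with t ht
    exact congrArg (· * _) ht
  rw [e1, e2, e3]
  linarith

/-- The trace operator on the energy space. -/
noncomputable def traceMap (hs : 0 < s) : EnergySpace s T hs →L[ℝ] TraceSpace T :=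
  (WithLp.fstL 2 ℝ _ _).comp (EnergySpace.inclusion hs)

theorem traceMap_apply (hs : 0 < s) (h : EnergySpace s T hs) :
    traceMap hs h = h.toTriple.fst := rfl

theorem Triple.norm_sq (x : Triple s T) :
    ‖x‖ ^ 2 = ‖x.fst‖ ^ 2 + (‖x.snd.fst‖ ^ 2 + ‖x.snd.snd‖ ^ 2) := by
  rw [WithLp.prod_norm_sq_eq_of_L2, WithLp.prod_norm_sq_eq_of_L2]

end EnergySpace

/-! ### Compactness of the trace operator. -/

section Compactness

theorem fderiv_mul_separated {f g : ℝ → ℝ} {f' g' : ℝ} {p : ℝ × ℝ} (hf : HasDerivAt f f' p.1)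
    (hg : HasDerivAt g g' p.2) :
    fderiv ℝ (fun p : ℝ × ℝ => f p.1 * g p.2) p (1, 0) = f' * g p.2 ∧
      fderiv ℝ (fun p : ℝ × ℝ => f p.1 * g p.2) p (0, 1) = f p.1 * g' := by
  have h1 := hf.comp_hasFDerivAt p (hasFDerivAt_fst (𝕜 := ℝ) (E := ℝ) (F := ℝ))
  have h2 := hg.comp_hasFDerivAt p (hasFDerivAt_snd (𝕜 := ℝ) (E := ℝ) (F := ℝ))
  have h3 : fderiv ℝ (fun p : ℝ × ℝ => f p.1 * g p.2) p = _ := (h1.mul h2).fderiv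
  rw [h3]
  constructor <;> simp [mul_comm]

/-- A smooth cutoff function that is `1` at the origin. -/
theorem exists_cutoff : ∃ χ : ℝ → ℝ, ∃ M : ℝ, ContDiff ℝ ∞ χ ∧ χ 0 = 1 ∧
    (∀ y, 1 ≤ |y| → χ y = 0) ∧ (∀ y, 1 ≤ |y| → deriv χ y = 0) ∧ (∀ y, |χ y| ≤ M) ∧
    ∀ y, |deriv χ y| ≤ M := by
  let b : ContDiffBump (0 : ℝ) := ⟨1 / 4, 1 / 2, by norm_num, by norm_num⟩
  have hc : ContDiff ℝ ∞ b := b.contDiff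
  obtain ⟨M1, h1⟩ := b.hasCompactSupport.exists_bound_of_continuous hc.continuous
  obtain ⟨M2, h2⟩ := b.hasCompactSupport.deriv.exists_bound_of_continuous
    (hc.continuous_deriv (by simp))
  have hz : ∀ y : ℝ, 1 / 2 ≤ |y| → b y = 0 := fun y hy =>
    b.zero_of_le_dist (by simpa [Real.dist_eq, b] using hy)
  refine ⟨b, max M1 M2, hc, b.one_of_mem_closedBall (by simp [b]), fun y hy => hz y (by linarith),
    fun y hy => ?_, fun y => (h1 y).trans (le_max_left _ _), fun y => (h2 y).trans (le_max_right _ _)⟩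
  have : b =ᶠ[𝓝 y] fun _ => 0 := by
    have ho : IsOpen {z : ℝ | 1 / 2 < |z|} := isOpen_lt continuous_const continuous_abs
    filter_upwards [ho.mem_nhds (by change 1 / 2 < |y|; linarith : y ∈ {z : ℝ | 1 / 2 < |z|})]
      with z hz'
    exact hz z (le_of_lt hz')
  rw [this.deriv_eq]; simp

variable {s T : ℝ}

/-- The functions `ψ ((|n| + 1) y)` times a trigonometric function, localised where the trace
operator sees the frequency `n`. -/
noncomputable def layer (T : ℝ) (ψ : ℝ → ℝ) (m n : ℤ) (p : ℝ × ℝ) : ℝ :=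
  trig T m p.1 * ψ ((|(n : ℝ)| + 1) * p.2)

theorem measurable_layer {ψ : ℝ → ℝ} (hψ : Measurable ψ) (m n : ℤ) :
    Measurable (layer T ψ m n) := by
  have := (continuous_trig T m).measurable
  unfold layer; fun_prop

theorem layer_eq_zero {ψ : ℝ → ℝ} (hψ : ∀ y, 1 ≤ |y| → ψ y = 0) (m n : ℤ) (p : ℝ × ℝ)
    (hp : 1 / (|(n : ℝ)| + 1) ≤ |p.2|) : layer T ψ m n p = 0 := by
  rw [layer, hψ, mul_zero]
  have h0 : (0 : ℝ) < |(n : ℝ)| + 1 := by positivity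
  rw [div_le_iff₀ h0] at hp
  rw [abs_mul, abs_of_pos h0]; linarith

theorem abs_layer_le {ψ : ℝ → ℝ} {M : ℝ} (hψ : ∀ y, |ψ y| ≤ M) (m n : ℤ) (p : ℝ × ℝ) :
    |layer T ψ m n p| ≤ 2 / √T * M := by
  rw [layer, abs_mul]
  exact mul_le_mul (abs_trig_le T m _) (hψ _) (abs_nonneg _) (by positivity)

theorem memLp_layer (hs : 0 < s) {ψ : ℝ → ℝ} (hm : Measurable ψ) {M : ℝ} (hM : ∀ y, |ψ y| ≤ M)
    (hψ : ∀ y, 1 ≤ |y| → ψ y = 0) (m n : ℤ) :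
    MemLp (stripDual s (layer T ψ m n)) 2 (weight s T) :=
  memLp_stripDual hs (measurable_layer hm m n) (R := 1 / (|(n : ℝ)| + 1)) (by positivity)
    (fun p _ => abs_layer_le hM m n p) fun p hp =>
      layer_eq_zero hψ m n p (hp.le.trans (le_abs_self _))

/-- The layer lives at heights below `1/(|n|+1)`, where `y^(2s-1)` has integral `(1/(|n|+1))^(2s) /
(2s)`. This is the source of the decay in `n`. -/
theorem norm_layer_sq_le (hs : 0 < s) (hT : 0 < T) {ψ : ℝ → ℝ} (hm : Measurable ψ) {M : ℝ}
    (hM : ∀ y, |ψ y| ≤ M) (hψ : ∀ y, 1 ≤ |y| → ψ y = 0) (m n : ℤ) :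
    ‖(memLp_layer (s := s) (T := T) hs hm hM hψ m n).toLp‖ ^ 2 ≤
      2 * M ^ 2 / s * (1 / (|(n : ℝ)| + 1)) ^ (2 * s) := by
  refine (norm_stripDual_toLp_sq_le hs hT (R := 1 / (|(n : ℝ)| + 1)) (by positivity)
    (fun p _ => abs_layer_le hM m n p) (fun p hp =>
      layer_eq_zero hψ m n p (hp.le.trans (le_abs_self _))) _).trans (le_of_eq ?_)
  rw [mul_pow, div_pow, Real.sq_sqrt hT.le]
  field_simp

theorem inner_layer_eq_zero (hs : 0 < s) (hT : 0 < T) {ψ : ℝ → ℝ} (hm : Measurable ψ) {M : ℝ}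
    (hM : ∀ y, |ψ y| ≤ M) (hψ : ∀ y, 1 ≤ |y| → ψ y = 0) {m m' : ℤ} (n n' : ℤ) (hne : m ≠ m') :
    ⟪(memLp_layer (s := s) (T := T) hs hm hM hψ m n).toLp,
      (memLp_layer (s := s) (T := T) hs hm hM hψ m' n').toLp⟫_ℝ = 0 := by
  rw [inner_toLp_eq_integral, integral_congr_ae (g := fun p =>
    stripDual s (layer T ψ m' n') p * stripDual s (layer T ψ m n) p),
    integral_stripDual_mul_stripDual, restrict_strip]
  · have e : ∀ p : ℝ × ℝ, p.2 ^ (2 * s - 1) * (layer T ψ m' n' p * layer T ψ m n p) =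
      (trig T m' p.1 * trig T m p.1) * (p.2 ^ (2 * s - 1) *
        (ψ ((|(n' : ℝ)| + 1) * p.2) * ψ ((|(n : ℝ)| + 1) * p.2))) := fun p => by
      simp only [layer]; ring
    simp only [e]
    rw [integral_prod_mul (fun x => trig T m' x * trig T m x) (fun y => y ^ (2 * s - 1) *
        (ψ ((|(n' : ℝ)| + 1) * y) * ψ ((|(n : ℝ)| + 1) * y))), integral_trig_mul_trig hT,
      if_neg hne.symm, zero_mul]
  · filter_upwards [(memLp_layer (s := s) (T := T) hs hm hM hψ m' n').coeFn_toLp] with p hp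
    rw [hp]

/-- Layers of distinct horizontal frequencies are orthogonal whatever their vertical profiles, so
Bessel's inequality applies with the largest norm, attained at the lowest frequency allowed. The map
`f` is needed both as the identity and as negation. -/
theorem sum_inner_layer_sq_le (hs : 0 < s) (hT : 0 < T) {ψ : ℝ → ℝ} (hm : Measurable ψ) {M : ℝ}
    (hM : ∀ y, |ψ y| ≤ M) (hψ : ∀ y, 1 ≤ |y| → ψ y = 0) {f : ℤ → ℤ} (hf : f.Injective)
    (t : Finset ℤ) {N : ℝ} (hN : 0 ≤ N) (ht : ∀ n ∈ t, N ≤ |(n : ℝ)|) (x : GradSpace s T) :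
    ∑ n ∈ t, ⟪(memLp_layer (s := s) (T := T) hs hm hM hψ (f n) n).toLp, x⟫_ℝ ^ 2 ≤
      2 * M ^ 2 / s * (1 / (N + 1)) ^ (2 * s) * ‖x‖ ^ 2 := by
  have h0 : 0 ≤ 2 * M ^ 2 / s * (1 / (N + 1)) ^ (2 * s) := by positivity
  have := sum_inner_sq_le_of_orthogonal
    (fun n => (memLp_layer (s := s) (T := T) hs hm hM hψ (f n) n).toLp) t
    (r := √(2 * M ^ 2 / s * (1 / (N + 1)) ^ (2 * s)))
    (fun n hn => Real.le_sqrt_of_sq_le ((norm_layer_sq_le hs hT hm hM hψ _ _).trans ?_))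
    (fun i _ j _ hij => inner_layer_eq_zero hs hT hm hM hψ _ _ (hf.ne hij)) x
  · rwa [Real.sq_sqrt h0] at this
  · have := ht n hn
    gcongr

theorem isTest_layer (hT : 0 < T) {ψ : ℝ → ℝ} (hψ : ContDiff ℝ ∞ ψ)
    (h0 : ∀ y, 1 ≤ |y| → ψ y = 0) (m n : ℤ) : IsTest T (layer T ψ m n) where
  smooth := by
    have := contDiff_trig T m
    unfold layer; fun_prop
  periodic x y := by simp only [layer, (trig_periodic hT m) x]
  support := ⟨1 / (|(n : ℝ)| + 1), fun x y hy => layer_eq_zero h0 m n (x, y) hy⟩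

/-- Test the curl constraint with frequency `-n`: its horizontal derivative has frequency `n` and
boundary value a multiple of `trig T n`, because `χ 0 = 1`. Solving for the boundary term expresses
the coefficient of the trace by pairings with `Q` and `P`. -/
theorem sq_inner_traceMap_le (hs : 0 < s) (hT : 0 < T) {χ : ℝ → ℝ} {M : ℝ} (hχ : ContDiff ℝ ∞ χ)
    (hχ0 : χ 0 = 1) (hm : Measurable χ) (hm' : Measurable (deriv χ)) (hM : ∀ y, |χ y| ≤ M)
    (hM' : ∀ y, |deriv χ y| ≤ M) (hχs : ∀ y, 1 ≤ |y| → χ y = 0)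
    (hχs' : ∀ y, 1 ≤ |y| → deriv χ y = 0) (h : EnergySpace s T hs) {n : ℤ} (hn : n ≠ 0) :
    ⟪trigBasis hT n, traceMap hs h⟫_ℝ ^ 2 ≤
      2 * ⟪(memLp_layer (s := s) (T := T) hs hm hM hχs n n).toLp, h.toTriple.snd.snd⟫_ℝ ^ 2 +
      2 * (T / Real.pi) ^ 2 * ⟪(memLp_layer (s := s) (T := T) hs hm' hM' hχs' (-n) n).toLp,
        h.toTriple.snd.fst⟫_ℝ ^ 2 := by
  have hd := (mem_energySubmodule_iff hs _).1 h.toTriple_mem _ (isTest_layer hT hχ hχs (-n) n)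
  have hd' : ∀ p : ℝ × ℝ, fderiv ℝ (layer T χ (-n) n) p (1, 0) =
      -(2 * Real.pi * n / T) * layer T χ n n p ∧ fderiv ℝ (layer T χ (-n) n) p (0, 1) =
        (|(n : ℝ)| + 1) * layer T (deriv χ) (-n) n p := fun p => by
    have h1 := hasDerivAt_trig T (-n) p.1
    have h2 : HasDerivAt (fun y => χ ((|(n : ℝ)| + 1) * y))
        (deriv χ ((|(n : ℝ)| + 1) * p.2) * (|(n : ℝ)| + 1)) p.2 := by
      refine HasDerivAt.comp p.2 (hχ.differentiable (by simp) _).hasDerivAt ?_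
      simpa using (hasDerivAt_id p.2).const_mul (|(n : ℝ)| + 1)
    obtain ⟨e1, e2⟩ := fderiv_mul_separated h1 h2
    refine ⟨Eq.trans e1 ?_, Eq.trans e2 ?_⟩
    · rw [neg_neg, layer]; push_cast; ring
    · rw [layer]; ring
  have htr : ∀ t, layer T χ n n (t, 0) = trig T n t := fun t => by simp [layer, hχ0]
  simp only [fun p => (hd' p).1, fun p => (hd' p).2, htr, mul_left_comm _ (-(_ : ℝ)),
    mul_left_comm _ (|(n : ℝ)| + 1), integral_const_mul] at hd
  rw [← inner_stripDual_toLp (memLp_layer (s := s) (T := T) hs hm hM hχs n n),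
    ← inner_stripDual_toLp (memLp_layer (s := s) (T := T) hs hm' hM' hχs' (-n) n),
    ← inner_toLp_eq_integral (memLp_trig T n), ← trigBasis_apply hT, ← traceMap_apply] at hd
  set a := ⟪trigBasis hT n, traceMap hs h⟫_ℝ
  set q := ⟪(memLp_layer (s := s) (T := T) hs hm hM hχs n n).toLp, h.toTriple.snd.snd⟫_ℝ
  set b := ⟪(memLp_layer (s := s) (T := T) hs hm' hM' hχs' (-n) n).toLp,
      h.toTriple.snd.fst⟫_ℝ
  have hn1 : (1 : ℝ) ≤ |(n : ℝ)| := by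
    exact_mod_cast Int.one_le_abs hn
  have hn0 : (n : ℝ) ≠ 0 := by exact_mod_cast hn
  have hpi := Real.pi_pos
  set c := (|(n : ℝ)| + 1) * T / (2 * Real.pi * n) with hc
  have ha : a = -q - c * b := by
    have : c * ((|(n : ℝ)| + 1) * b) = -((|(n : ℝ)| + 1) * (a + q)) := by
      rw [← hd, hc]; field_simp; ring
    have h3 : (|(n : ℝ)| + 1) * (a + q + c * b) = 0 := by linarith
    have h4 := (mul_eq_zero.1 h3).resolve_left (by positivity)
    linarith
  -- For `n ≠ 0` one has `|n| + 1 ≤ 2|n|`: the vertical scale is matched to the frequency so that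
  -- `c` stays bounded.
  have hc2 : c ^ 2 ≤ (T / Real.pi) ^ 2 := by
    rw [← sq_abs c, hc, abs_div, abs_mul, abs_mul, abs_mul, abs_of_pos hT, abs_of_pos hpi, abs_two,
      abs_of_pos (by positivity : 0 < |(n : ℝ)| + 1)]
    refine pow_le_pow_left₀ (by positivity) ?_ 2
    rw [div_le_div_iff₀ (by positivity) hpi]
    nlinarith [mul_pos hT hpi]
  rw [ha]
  nlinarith [sq_nonneg (q - c * b), mul_le_mul_of_nonneg_right hc2 (sq_nonneg b)]

theorem exists_sum_sq_inner_traceMap_le (hs : 0 < s) (hT : 0 < T) :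
    ∃ C > 0, ∀ (N : ℕ) (h : EnergySpace s T hs) (t : Finset ℤ),
      (∀ n ∈ t, (N : ℝ) ≤ |(n : ℝ)| ∧ n ≠ 0) →
      ∑ n ∈ t, ⟪trigBasis hT n, traceMap hs h⟫_ℝ ^ 2 ≤
        C * (1 / ((N : ℝ) + 1)) ^ (2 * s) * ‖h‖ ^ 2 := by
  obtain ⟨χ, M, hχ, hχ0, hχs, hχs', hM, hM'⟩ := exists_cutoff
  have hm : Measurable χ := hχ.continuous.measurable
  have hm' : Measurable (deriv χ) := (hχ.continuous_deriv (by simp)).measurable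
  have hM0 : 0 < M := by
    have := hM 0
    rw [hχ0, abs_one] at this; linarith
  refine ⟨2 * (1 + (T / Real.pi) ^ 2) * (2 * M ^ 2 / s), by positivity, fun N h t ht' => ?_⟩
  have hQ := sum_inner_layer_sq_le (f := fun n => n) hs hT hm hM hχs (fun _ _ h => h) t N.cast_nonneg
    (fun n hn => (ht' n hn).1) h.toTriple.snd.snd
  have hP := sum_inner_layer_sq_le hs hT hm' hM' hχs' neg_injective t N.cast_nonneg
    (fun n hn => (ht' n hn).1) h.toTriple.snd.fst
  have hsum := Finset.sum_le_sum fun n hn =>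
    sq_inner_traceMap_le hs hT hχ hχ0 hm hm' hM hM' hχs hχs' h (ht' n hn).2
  rw [Finset.sum_add_distrib, ← Finset.mul_sum, ← Finset.mul_sum] at hsum
  have hnorm := Triple.norm_sq h.toTriple
  set D := 2 * M ^ 2 / s * (1 / ((N : ℝ) + 1)) ^ (2 * s) with hD
  have hD0 : 0 ≤ D := by positivity
  rw [← EnergySpace.norm_toTriple, hnorm]
  have i1 : 0 ≤ D * ‖h.toTriple.snd.snd‖ ^ 2 := by positivity
  have i2 : 0 ≤ D * ‖h.toTriple.snd.fst‖ ^ 2 := by positivity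
  have i3 : 0 ≤ D * ‖h.toTriple.fst‖ ^ 2 := by positivity
  have i4 : 0 ≤ (T / Real.pi) ^ 2 := by positivity
  have i5 := mul_le_mul_of_nonneg_left hP i4
  generalize ‖h.toTriple.fst‖ ^ 2 = x at *
  generalize ‖h.toTriple.snd.fst‖ ^ 2 = y at *
  generalize ‖h.toTriple.snd.snd‖ ^ 2 = z at *
  calc _ ≤ _ := hsum
    _ ≤ 2 * (D * z) + 2 * ((T / Real.pi) ^ 2 * (D * y)) := by linarith
    _ ≤ 2 * (1 + (T / Real.pi) ^ 2) * D * (x + (y + z)) := by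
      nlinarith [mul_nonneg i4 i1, mul_nonneg i4 i3]
    _ = _ := by rw [hD]; ring

theorem isCompactOperator_traceMap (hs : 0 < s) (hT : 0 < T) :
    IsCompactOperator (traceMap hs : EnergySpace s T hs →L[ℝ] TraceSpace T) := by
  obtain ⟨C, hC, hsum⟩ := exists_sum_sq_inner_traceMap_le hs hT
  refine isCompactOperator_of_hilbertBasis_tails (H := EnergySpace s T hs) (trigBasis hT) _
    fun ε hε => ?_
  have hlim : Tendsto (fun N : ℕ => C * (1 / ((N : ℝ) + 1)) ^ (2 * s)) atTop (𝓝 0) := by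
    have h1 := tendsto_one_div_add_atTop_nhds_zero_nat (𝕜 := ℝ)
    have h2 := (h1.rpow_const (p := 2 * s) (Or.inr (by positivity))).const_mul C
    rwa [Real.zero_rpow (by positivity), mul_zero] at h2
  obtain ⟨N, hN⟩ := (hlim.eventually (gt_mem_nhds (by positivity : 0 < ε ^ 2))).exists
  refine ⟨Finset.Icc (-N) N, fun h t ht => (hsum N h t fun n hn => ?_).trans (by gcongr)⟩
  have h1 : n ∉ Finset.Icc (-(N : ℤ)) N := Finset.disjoint_left.1 ht hn
  rw [Finset.mem_Icc, ← abs_le, not_le] at h1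
  refine ⟨by exact_mod_cast h1.le, fun h0 => ?_⟩
  rw [h0, abs_zero] at h1; omega

end Compactness

variable {s T : ℝ}

/-! ### Vertical primitives of test functions. -/

section Primitive

/-- The primitive `∫_y^∞ φ(x, z) dz` of a test function in the second variable. -/
noncomputable def tailPrimitive (φ : ℝ × ℝ → ℝ) (p : ℝ × ℝ) : ℝ :=
  convolution ((Iic (0 : ℝ)).indicator fun _ => (1 : ℝ)) (fun y => φ (p.1, y))
    (ContinuousLinearMap.mul ℝ ℝ) volume p.2

theorem tailPrimitive_eq {φ : ℝ × ℝ → ℝ} {R : ℝ} (hR : ∀ x y, R ≤ |y| → φ (x, y) = 0) (x y : ℝ) :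
    tailPrimitive φ (x, y) = ∫ z in y..R, φ (x, z) := by
  have e1 : tailPrimitive φ (x, y) = ∫ z in Ici y, φ (x, z) := by
    rw [tailPrimitive, convolution_eq_swap, ← integral_indicator measurableSet_Ici]
    congr 1; ext z
    by_cases hz : y ≤ z
    · simp [hz]
    · simp [hz]
  rw [e1]
  rcases le_total y R with h | h
  · rw [intervalIntegral.integral_of_le h, integral_Ici_eq_integral_Ioi]
    refine setIntegral_eq_of_subset_of_forall_sdiff_eq_zero measurableSet_Ioi Ioc_subset_Ioi_self
      fun z hz => hR x z (le_trans ?_ (le_abs_self z))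
    have := hz.2
    simp only [mem_Ioc, not_and, not_le] at this
    exact (this hz.1).le
  · rw [intervalIntegral.integral_of_ge h, setIntegral_eq_zero_of_forall_eq_zero,
      setIntegral_eq_zero_of_forall_eq_zero, neg_zero]
    · exact fun z hz => hR x z (hz.1.le.trans (le_abs_self z))
    · exact fun z hz => hR x z ((h.trans hz).trans (le_abs_self z))

/-- As a convolution in `y` with a half-line indicator, the primitive is jointly smooth: the support
of `φ` in `y` is bounded uniformly in `x`. -/
theorem contDiff_tailPrimitive {φ : ℝ × ℝ → ℝ} (hφ : IsTest T φ) :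
    ContDiff ℝ ∞ (tailPrimitive φ) := by
  obtain ⟨R, hR⟩ := hφ.support
  rw [← contDiffOn_univ, ← univ_prod_univ]
  refine contDiffOn_convolution_right_with_param (n := ⊤) (ContinuousLinearMap.mul ℝ ℝ)
    (g := fun x y => φ (x, y)) (k := Icc (-R) R) isOpen_univ isCompact_Icc (fun x y _ hy => ?_)
    ((locallyIntegrable_const (1 : ℝ)).indicator measurableSet_Iic) hφ.smooth.contDiffOn
  refine hR x y (le_of_lt ?_)
  rw [mem_Icc, ← abs_le, not_le] at hy
  exact hy

theorem fderiv_tailPrimitive {φ : ℝ × ℝ → ℝ} (hφ : IsTest T φ) (p : ℝ × ℝ) :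
    fderiv ℝ (tailPrimitive φ) p (0, 1) = -φ p := by
  obtain ⟨R, hR⟩ := hφ.support
  obtain ⟨x, y⟩ := p
  have hc : Continuous fun z => φ (x, z) := hφ.continuous.comp (by fun_prop)
  have h1 : HasDerivAt (fun y => tailPrimitive φ (x, y)) (-φ (x, y)) y := by
    simp only [tailPrimitive_eq hR]
    exact intervalIntegral.integral_hasDerivAt_left (hc.intervalIntegrable _ _)
      (hc.stronglyMeasurableAtFilter _ _) hc.continuousAt
  have h2 : HasDerivAt (fun y => tailPrimitive φ (x, y))
      (fderiv ℝ (tailPrimitive φ) (x, y) (0, 1)) y := by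
    have h3 := ((contDiff_tailPrimitive hφ).differentiable (by simp) (x, y)).hasFDerivAt
    exact h3.comp_hasDerivAt y ((hasDerivAt_const y x).prodMk (hasDerivAt_id y))
  exact h2.unique h1

/-- A test function has a primitive in the second variable, up to the boundary, that is a test
function. -/
theorem IsTest.exists_primitive {φ : ℝ × ℝ → ℝ} (hφ : IsTest T φ) :
    ∃ Φ, IsTest T Φ ∧ ∀ p : ℝ × ℝ, 0 ≤ p.2 → fderiv ℝ Φ p (0, 1) = -φ p := by
  obtain ⟨R, hR⟩ := hφ.support
  -- The tail primitive need not vanish as `y → -∞`. The factor is `1` for `y ≥ -1` and `0` for `y ≤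
  -- -2`, so it restores bounded vertical support without changing the closed upper half-plane.
  refine ⟨fun p => tailPrimitive φ p * Real.smoothTransition (p.2 + 2), ⟨?_, ?_, ?_⟩, ?_⟩
  · exact (contDiff_tailPrimitive hφ).mul (Real.smoothTransition.contDiff.comp (by fun_prop))
  · intro x y
    simp only [tailPrimitive_eq hR, hφ.periodic]
  · refine ⟨max R 2, fun x y hy => ?_⟩
    rcases le_abs.1 hy with h | h
    · have h1 : R ≤ y := (le_max_left _ _).trans h
      have : tailPrimitive φ (x, y) = 0 := by
        rw [tailPrimitive_eq hR, intervalIntegral.integral_of_ge h1,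
          setIntegral_eq_zero_of_forall_eq_zero, neg_zero]
        exact fun z hz => hR x z (hz.1.le.trans (le_abs_self z))
      rw [this, zero_mul]
    · have h1 : (2 : ℝ) ≤ -y := (le_max_right _ _).trans h
      rw [Real.smoothTransition.zero_of_nonpos (by linarith), mul_zero]
  · intro p hp
    rw [← fderiv_tailPrimitive hφ p]
    have ho : IsOpen {q : ℝ × ℝ | -1 < q.2} := isOpen_lt continuous_const (by fun_prop)
    have : (fun p => tailPrimitive φ p * Real.smoothTransition (p.2 + 2)) =ᶠ[𝓝 p]
        tailPrimitive φ := by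
      filter_upwards [ho.mem_nhds (by change -1 < p.2; linarith : p ∈ {q : ℝ × ℝ | -1 < q.2})]
        with q hq
      replace hq : -1 < q.2 := hq
      rw [Real.smoothTransition.one_of_one_le (by linarith), mul_one]
    rw [this.fderiv_eq]

theorem IsTest.integral_fderiv {φ : ℝ × ℝ → ℝ} (hφ : IsTest T φ) {R : ℝ}
    (hR : ∀ x y, R ≤ |y| → φ (x, y) = 0) (x : ℝ) {t : ℝ} (ht : t ≤ R) :
    ∫ y in Ioc t R, fderiv ℝ φ (x, y) (0, 1) = -φ (x, t) := by
  have hc : Continuous fun y => fderiv ℝ φ (x, y) (0, 1) :=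
    (hφ.fderiv_apply (0, 1)).continuous.comp (by fun_prop)
  rw [← intervalIntegral.integral_of_le ht, intervalIntegral.integral_eq_sub_of_hasDerivAt
    (f := fun y => φ (x, y)) (fun y _ => ?_) (hc.intervalIntegrable _ _),
    hR x R (le_abs_self R), zero_sub]
  exact (hφ.differentiable (x, y)).hasFDerivAt.comp_hasDerivAt y
    ((hasDerivAt_const y x).prodMk (hasDerivAt_id y))

end Primitive

/-! ### Local integrability and Fubini over the triangle `t ≤ y`. -/

section Fubini

theorem restrict_box (T R : ℝ) : (volume : Measure (ℝ × ℝ)).restrict (period T ×ˢ Ioc 0 R) =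
    (volume.restrict (period T)).prod (volume.restrict (Ioc 0 R)) := by
  rw [Measure.prod_restrict]; rfl

/-- By Hölder in the weighted space: the dual function `y^(2s-1) 1_{y ≤ R}` is square integrable
there because `s > 0`. -/
theorem integrableOn_box_of_memLp (hs : 0 < s) {Q : ℝ × ℝ → ℝ} (hQ : MemLp Q 2 (weight s T))
    (R : ℝ) : IntegrableOn Q (period T ×ˢ Ioc 0 R) := by
  have hsub : period T ×ˢ Ioc 0 R ⊆ strip T := prod_mono le_rfl Ioc_subset_Ioi_self
  have hm : MeasurableSet {p : ℝ × ℝ | p.2 ≤ R} := measurableSet_le measurable_snd measurable_const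
  have h1 : MemLp (stripDual s ({p : ℝ × ℝ | p.2 ≤ R}.indicator fun _ => (1 : ℝ))) 2
      (weight s T) := by
    refine memLp_stripDual hs (measurable_const.indicator hm) (M := 1) (R := max R 0)
      (le_max_right _ _) (fun p _ => ?_) fun p hp => ?_
    · by_cases h : p ∈ {p : ℝ × ℝ | p.2 ≤ R} <;> simp [h]
    · refine indicator_of_notMem (fun h => ?_) _
      exact absurd ((le_max_left R 0).trans_lt hp) (not_lt.2 h)
  have h2 := (integrable_mul_stripDual_iff s T Q _).1 (hQ.integrable_mul h1)
  refine (h2.mono_set hsub).congr_fun (fun p hp => ?_)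
    ((measurableSet_period T).prod measurableSet_Ioc)
  simp only
  rw [indicator_of_mem (show p ∈ {p : ℝ × ℝ | p.2 ≤ R} from hp.2.2), mul_one]

/-- The exchange of the last two of three variables. -/
def exchange : (ℝ × ℝ) × ℝ ≃ᵐ (ℝ × ℝ) × ℝ :=
  (MeasurableEquiv.prodAssoc.trans
    ((MeasurableEquiv.refl ℝ).prodCongr MeasurableEquiv.prodComm)).trans
      MeasurableEquiv.prodAssoc.symm

theorem measurePreserving_exchange (μ ν : Measure ℝ) [SFinite μ] [SFinite ν] :
    MeasurePreserving exchange ((μ.prod ν).prod ν) ((μ.prod ν).prod ν) := by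
  have h1 := measurePreserving_prodAssoc μ ν ν
  have h2 : MeasurePreserving (Prod.map id Prod.swap) (μ.prod (ν.prod ν)) (μ.prod (ν.prod ν)) :=
    (MeasurePreserving.id μ).prod Measure.measurePreserving_swap
  exact ((measurePreserving_prodAssoc μ ν ν).symm _).comp (h2.comp h1)

variable {μ ν : Measure ℝ} [SFinite μ] [IsFiniteMeasure ν]

/-- The integrand of the double integral of `Q (x, t) ψ (x, y)` over `t ≤ y`. -/
noncomputable def triangle (Q ψ : ℝ × ℝ → ℝ) (q : (ℝ × ℝ) × ℝ) : ℝ :=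
  {q : (ℝ × ℝ) × ℝ | q.2 ≤ q.1.2}.indicator (fun q => Q (q.1.1, q.2) * ψ q.1) q

theorem integrable_triangle {Q ψ : ℝ × ℝ → ℝ} (hQ : Integrable Q (μ.prod ν)) (hψ : Continuous ψ)
    {M : ℝ} (hM : ∀ᵐ x ∂μ, ∀ y, |ψ (x, y)| ≤ M) :
    Integrable (triangle Q ψ) ((μ.prod ν).prod ν) := by
  have h1 : Integrable (fun q : (ℝ × ℝ) × ℝ => Q q.1) ((μ.prod ν).prod ν) := hQ.comp_fst ν
  have h2 : Integrable (fun q : (ℝ × ℝ) × ℝ => Q (q.1.1, q.2)) ((μ.prod ν).prod ν) :=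
    (measurePreserving_exchange μ ν).integrable_comp_of_integrable h1
  have hm : MeasurableSet {q : (ℝ × ℝ) × ℝ | q.2 ≤ q.1.2} :=
    measurableSet_le measurable_snd (measurable_snd.comp measurable_fst)
  refine (h2.mul_bdd (c := M) (g := fun q => ψ q.1)
    (Continuous.aestronglyMeasurable (by fun_prop)) ?_).indicator hm
  have h3 : ∀ᵐ p ∂μ.prod ν, |ψ p| ≤ M :=
    (Measure.quasiMeasurePreserving_fst (μ := μ) (ν := ν)).ae hM |>.mono fun p hp => hp p.2
  exact (Measure.quasiMeasurePreserving_fst (μ := μ.prod ν) (ν := ν)).ae h3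

theorem integral_triangle {Q ψ : ℝ × ℝ → ℝ} (h : Integrable (triangle Q ψ) ((μ.prod ν).prod ν)) :
    ∫ p, (∫ t, triangle Q ψ (p, t) ∂ν) ∂μ.prod ν =
      ∫ p, (∫ y, triangle Q ψ ((p.1, y), p.2) ∂ν) ∂μ.prod ν := by
  have he := measurePreserving_exchange μ ν
  rw [← integral_prod _ h, ← he.integral_comp exchange.measurableEmbedding,
    integral_prod (fun q => triangle Q ψ (exchange q)) (he.integrable_comp_of_integrable h)]
  rfl

end Fubini

variable {s T : ℝ}

/-! ### Recovering a function from its trace and gradient. -/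

section Extension

theorem integral_triangle_left {Q ψ : ℝ × ℝ → ℝ} {R x y : ℝ} (hy : y ≤ R) :
    ∫ t in Ioc 0 R, triangle Q ψ ((x, y), t) = (∫ t in Ioc 0 y, Q (x, t)) * ψ (x, y) := by
  have e : ∀ t, triangle Q ψ ((x, y), t) =
      (Iic y).indicator (fun t => Q (x, t) * ψ (x, y)) t := fun t => by
    by_cases h : t ≤ y <;> simp [triangle, h]
  simp only [e]
  rw [setIntegral_indicator measurableSet_Iic, ← integral_mul_const]
  congr 2
  ext t; simp only [mem_inter_iff, mem_Ioc, mem_Iic]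
  exact ⟨fun h => ⟨h.1.1, h.2⟩, fun h => ⟨⟨h.1, h.2.trans hy⟩, h.2⟩⟩

theorem integral_triangle_right {Q ψ : ℝ × ℝ → ℝ} {R x t : ℝ} (ht : 0 < t) :
    ∫ y in Ioc 0 R, triangle Q ψ ((x, y), t) = Q (x, t) * ∫ y in Ioc t R, ψ (x, y) := by
  have e : ∀ y, triangle Q ψ ((x, y), t) =
      (Ici t).indicator (fun y => Q (x, t) * ψ (x, y)) y := fun y => by
    by_cases h : t ≤ y <;> simp [triangle, h]
  simp only [e]
  rw [setIntegral_indicator measurableSet_Ici, ← integral_const_mul, ← integral_Icc_eq_integral_Ioc]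
  congr 2
  ext y; simp only [mem_inter_iff, mem_Ioc, mem_Ici, mem_Icc]
  exact ⟨fun h => ⟨h.2, h.1.2⟩, fun h => ⟨⟨ht.trans_le h.1, h.2⟩, h.1⟩⟩

/-- The function with boundary values `u` and vertical derivative `Q` on the strip, extended
periodically. -/
noncomputable def extension (hT : 0 < T) (u : ℝ → ℝ) (Q : ℝ × ℝ → ℝ) (p : ℝ × ℝ) : ℝ :=
  u (toIocMod hT (-(T / 2)) p.1) + ∫ t in Ioc 0 p.2, Q (toIocMod hT (-(T / 2)) p.1, t)

theorem toIocMod_eq_of_mem_period (hT : 0 < T) {x : ℝ} (hx : x ∈ period T) :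
    toIocMod hT (-(T / 2)) x = x :=
  (toIocMod_eq_self hT).2 ⟨hx.1, hx.2.trans (by linarith)⟩

theorem extension_apply (hT : 0 < T) (u : ℝ → ℝ) (Q : ℝ × ℝ → ℝ) {p : ℝ × ℝ}
    (hp : p.1 ∈ period T) : extension hT u Q p = u p.1 + ∫ t in Ioc 0 p.2, Q (p.1, t) := by
  rw [extension, toIocMod_eq_of_mem_period hT hp]

theorem extension_zero (hT : 0 < T) (u : ℝ → ℝ) (Q : ℝ × ℝ → ℝ) (x : ℝ) :
    extension hT u Q (x, 0) = u (toIocMod hT (-(T / 2)) x) := by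
  simp [extension]

theorem extension_periodic (hT : 0 < T) (u : ℝ → ℝ) (Q : ℝ × ℝ → ℝ) (x y : ℝ) :
    extension hT u Q (x + T, y) = extension hT u Q (x, y) := by
  simp [extension]

theorem integrableOn_extension (hT : 0 < T) {u : ℝ → ℝ} {Q : ℝ × ℝ → ℝ} {R : ℝ}
    (hu : IntegrableOn u (period T)) (hQ : IntegrableOn Q (period T ×ˢ Ioc 0 R)) :
    IntegrableOn (extension hT u Q) (period T ×ˢ Ioc 0 R) := by
  have hQ' := hQ
  rw [IntegrableOn, restrict_box] at hQ'
  have h1 := (integrable_triangle hQ' (ψ := fun _ => 1) continuous_const (M := 1)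
    (ae_of_all _ fun x y => by simp)).integral_prod_left
  have h2 : Integrable (fun p : ℝ × ℝ => u p.1)
      ((volume.restrict (period T)).prod (volume.restrict (Ioc 0 R))) := hu.comp_fst _
  have h3 := h2.add h1
  rw [← restrict_box] at h3
  refine IntegrableOn.congr_fun h3 (fun p hp => ?_)
    ((measurableSet_period T).prod measurableSet_Ioc)
  rw [extension_apply hT u Q hp.1, Pi.add_apply, integral_triangle_left hp.2.2, mul_one]

/-- After restriction to a box containing the support, Fubini over `t ≤ y` moves the primitive from
`Q` to `∂φ/∂y`, and the fundamental theorem of calculus applies to `φ` alone. The part `u(x)` yields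
the boundary term. -/
theorem integral_extension_mul_fderiv (hT : 0 < T) {u : ℝ → ℝ} {Q : ℝ × ℝ → ℝ}
    (hu : IntegrableOn u (period T)) (hQ : ∀ R, IntegrableOn Q (period T ×ˢ Ioc 0 R))
    {φ : ℝ × ℝ → ℝ} (hφ : IsTest T φ) :
    ∫ p in strip T, extension hT u Q p * fderiv ℝ φ p (0, 1) =
      -(∫ p in strip T, Q p * φ p) - ∫ x in period T, u x * φ (x, 0) := by
  obtain ⟨M, R₂, -, hM, hR₂⟩ := (hφ.fderiv_apply (0, 1)).exists_bound
  obtain ⟨-, R₁, hR₁0, -, hR₁⟩ := hφ.exists_bound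
  set R := max R₁ R₂
  have hR0 : 0 ≤ R := hR₁0.le.trans (le_max_left _ _)
  have hR : ∀ x y, R ≤ |y| → φ (x, y) = 0 := fun x y hy => hR₁ x y ((le_max_left _ _).trans hy)
  have hR' : ∀ x y, R ≤ |y| → fderiv ℝ φ (x, y) (0, 1) = 0 :=
    fun x y hy => hR₂ x y ((le_max_right _ _).trans hy)
  have hc : Continuous fun p => fderiv ℝ φ p (0, 1) := (hφ.fderiv_apply (0, 1)).continuous
  have hmbox : MeasurableSet (period T ×ˢ Ioc 0 R) := (measurableSet_period T).prod measurableSet_Ioc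
  have hsub : period T ×ˢ Ioc 0 R ⊆ strip T := prod_mono le_rfl Ioc_subset_Ioi_self
  have hout : ∀ p ∈ strip T \ period T ×ˢ Ioc 0 R, R ≤ |p.2| := fun p hp => by
    by_contra! h
    exact hp.2 ⟨hp.1.1, hp.1.2, ((le_abs_self _).trans_lt h).le⟩
  rw [setIntegral_eq_of_subset_of_forall_sdiff_eq_zero (measurableSet_strip T) hsub
      (fun p hp => by rw [hR' p.1 p.2 (hout p hp), mul_zero]),
    setIntegral_eq_of_subset_of_forall_sdiff_eq_zero (measurableSet_strip T) hsub
      (fun p hp => by rw [hR p.1 p.2 (hout p hp), mul_zero])]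
  have hQ' := hQ R
  rw [IntegrableOn, restrict_box] at hQ'
  have hM' : ∀ᵐ x ∂volume.restrict (period T), ∀ y, |fderiv ℝ φ (x, y) (0, 1)| ≤ M :=
    (ae_restrict_iff' (measurableSet_period T)).2 (ae_of_all _ fun x hx => hM x hx)
  have hF := integrable_triangle hQ' hc hM'
  have hmain := integral_triangle hF
  have i1 : Integrable (fun p : ℝ × ℝ => u p.1 * fderiv ℝ φ p (0, 1))
      ((volume.restrict (period T)).prod (volume.restrict (Ioc 0 R))) := by
    refine (hu.comp_fst _).mul_bdd (c := M) hc.aestronglyMeasurable ?_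
    exact (Measure.quasiMeasurePreserving_fst.ae hM').mono fun p hp => hp p.2
  have e1 : ∫ p in period T ×ˢ Ioc 0 R, extension hT u Q p * fderiv ℝ φ p (0, 1) =
      (∫ p in period T ×ˢ Ioc 0 R, u p.1 * fderiv ℝ φ p (0, 1)) +
        ∫ p in period T ×ˢ Ioc 0 R,
          ∫ t in Ioc 0 R, triangle Q (fun p => fderiv ℝ φ p (0, 1)) (p, t) := by
    rw [← integral_add]
    · refine setIntegral_congr_fun hmbox fun p hp => ?_
      rw [extension_apply hT u Q hp.1, integral_triangle_left hp.2.2, add_mul]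
    · rw [restrict_box]; exact i1
    · rw [restrict_box]; exact hF.integral_prod_left
  have e2 : ∫ p in period T ×ˢ Ioc 0 R, u p.1 * fderiv ℝ φ p (0, 1) =
      -∫ x in period T, u x * φ (x, 0) := by
    rw [restrict_box, integral_prod _ i1, ← integral_neg]
    congr 1; ext x
    simp only
    rw [integral_const_mul, hφ.integral_fderiv hR x hR0, mul_neg]
  have e3 : ∫ p in period T ×ˢ Ioc 0 R, (∫ y in Ioc 0 R,
      triangle Q (fun p => fderiv ℝ φ p (0, 1)) ((p.1, y), p.2)) =
        -∫ p in period T ×ˢ Ioc 0 R, Q p * φ p := by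
    rw [← integral_neg]
    refine setIntegral_congr_fun hmbox fun p hp => ?_
    rw [integral_triangle_right hp.2.1, hφ.integral_fderiv hR p.1 hp.2.2, mul_neg]
  rw [e1, e2]
  rw [← restrict_box] at hmain
  rw [hmain, e3]
  ring

theorem memL2_periodization (hT : 0 < T) (f : TraceSpace T) :
    MemL2 T fun x => f (toIocMod hT (-(T / 2)) x) where
  periodic x := by simp
  memLp := by
    refine (Lp.memLp f).ae_eq ?_
    refine (ae_restrict_iff' (measurableSet_period T)).2 (ae_of_all _ fun x hx => ?_)
    simp only [toIocMod_eq_of_mem_period hT hx]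

/-- Every element of the energy space is the triple of the trace and the weak gradient of a function
of finite energy. -/
theorem memEnergy_extension (hs : 0 < s) (hT : 0 < T) (h : EnergySpace s T hs) :
    MemEnergy s T (extension hT h.toTriple.fst h.toTriple.snd.snd)
      h.toTriple.snd.fst h.toTriple.snd.snd := by
  have hu : IntegrableOn h.toTriple.fst (period T) :=
    (Lp.memLp h.toTriple.fst).integrable one_le_two
  have hQ := integrableOn_box_of_memLp hs (Lp.memLp h.toTriple.snd.snd)
  have hdy := fun φ (hφ : IsTest T φ) => integral_extension_mul_fderiv hT hu hQ hφ
  have hzero : ∀ x ∈ period T, extension hT h.toTriple.fst h.toTriple.snd.snd (x, 0) =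
      h.toTriple.fst x := fun x hx => by
    rw [extension_zero, toIocMod_eq_of_mem_period hT hx]
  refine ⟨fun x y _ => extension_periodic hT _ _ x y, fun R => integrableOn_extension hT hu (hQ R),
    ?_, Lp.memLp _, Lp.memLp _, fun φ hφ => ?_, fun φ hφ => ?_⟩
  · simp only [extension_zero]
    exact memL2_periodization hT _
  -- Choose `Φ` with `∂Φ/∂y = -φ` on the half-plane. The vertical formula for `∂Φ/∂x` and the curl
  -- constraint for `Φ` share their boundary and `Q` terms; eliminating these leaves the horizontal
  -- formula for `φ`.
  · obtain ⟨Φ, hΦ, hd⟩ := hφ.exists_primitive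
    have h1 := (mem_energySubmodule_iff hs _).1 h.toTriple_mem Φ hΦ
    have h2 := hdy _ (hΦ.fderiv_apply (1, 0))
    have e1 : ∫ p in strip T, extension hT h.toTriple.fst h.toTriple.snd.snd p *
        fderiv ℝ (fun q => fderiv ℝ Φ q (1, 0)) p (0, 1) =
        -∫ p in strip T, extension hT h.toTriple.fst h.toTriple.snd.snd p *
          fderiv ℝ φ p (1, 0) := by
      rw [← integral_neg]
      refine setIntegral_congr_fun (measurableSet_strip T) fun p hp => ?_
      have hp' : (0 : ℝ) < p.2 := hp.2
      have : (fun q => fderiv ℝ Φ q (0, 1)) =ᶠ[𝓝 p] fun q => -φ q := by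
        have ho : IsOpen {q : ℝ × ℝ | 0 < q.2} := isOpen_lt continuous_const (by fun_prop)
        filter_upwards [ho.mem_nhds hp'] with q hq
        exact hd q (le_of_lt hq)
      rw [hΦ.fderiv_fderiv_comm, this.fderiv_eq, fderiv_fun_neg]
      simp
    have e2 : ∫ p in strip T, h.toTriple.snd.fst p * fderiv ℝ Φ p (0, 1) =
        -∫ p in strip T, h.toTriple.snd.fst p * φ p := by
      rw [← integral_neg]
      refine setIntegral_congr_fun (measurableSet_strip T) fun p hp => ?_
      rw [hd p (le_of_lt hp.2), mul_neg]
    rw [e1] at h2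
    rw [e2] at h1
    linarith
  · rw [hdy φ hφ]
    congr 1
    refine setIntegral_congr_fun (measurableSet_period T) fun x hx => ?_
    rw [hzero x hx]

end Extension

variable {s T : ℝ}

/-! ### From one period to the whole line. -/

section Periodic

theorem ae_eq_of_periodic (hT : 0 < T) {u v : ℝ → ℝ} (hu : Function.Periodic u T)
    (hv : Function.Periodic v T) (h : u =ᵐ[volume.restrict (period T)] v) : u =ᵐ[volume] v := by
  have hd : IsAddFundamentalDomain (AddSubgroup.zmultiples T) (period T) := by
    have := isAddFundamentalDomain_Ioc hT (-(T / 2))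
    rwa [show -(T / 2) + T = T / 2 by ring] at this
  refine hd.measure_zero_of_invariant {x | u x = v x}ᶜ (fun g => ?_) ?_
  · obtain ⟨_, n, rfl⟩ := g
    ext x
    rw [Set.mem_vadd_set_iff_neg_vadd_mem]
    have h1 : u (-(n • T) + x) = u x := by
      rw [neg_add_eq_sub]; exact hu.sub_zsmul_eq n
    have h2 : v (-(n • T) + x) = v x := by
      rw [neg_add_eq_sub]; exact hv.sub_zsmul_eq n
    change ¬ u (-(n • T) + x) = v (-(n • T) + x) ↔ ¬ u x = v x
    rw [h1, h2]
  · rw [Filter.EventuallyEq, ae_restrict_iff' (measurableSet_period T)] at h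
    refine measure_mono_null (fun x hx => ?_) h
    exact fun h' => hx.1 (h' hx.2)

end Periodic

/-! ### The form on the energy space and weak solutions. -/

section Form

variable {k : ℝ → ℝ}

/-- Multiplication by a bounded function on the `L²` space of a period. -/
noncomputable def mulOp (T : ℝ) {k : ℝ → ℝ} (hk : MemLp k ⊤ (volume.restrict (period T))) :
    TraceSpace T →L[ℝ] TraceSpace T :=
  (ContinuousLinearMap.mul ℝ ℝ).holderL (volume.restrict (period T)) ⊤ 2 2 hk.toLp

theorem mulOp_coeFn (hk : MemLp k ⊤ (volume.restrict (period T))) (f : TraceSpace T) :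
    mulOp T hk f =ᵐ[volume.restrict (period T)] fun x => k x * f x := by
  have h := (ContinuousLinearMap.mul ℝ ℝ).coeFn_holder (r := 2) hk.toLp f
  filter_upwards [h, hk.coeFn_toLp] with x h1 h2
  rw [h2] at h1
  exact h1

/-- The first component of the gradient, on the energy space. -/
noncomputable def dxMap (hs : 0 < s) : EnergySpace s T hs →L[ℝ] GradSpace s T :=
  (WithLp.fstL 2 ℝ _ _).comp ((WithLp.sndL 2 ℝ _ _).comp (EnergySpace.inclusion hs))

/-- The second component of the gradient, on the energy space. -/
noncomputable def dyMap (hs : 0 < s) : EnergySpace s T hs →L[ℝ] GradSpace s T :=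
  (WithLp.sndL 2 ℝ _ _).comp ((WithLp.sndL 2 ℝ _ _).comp (EnergySpace.inclusion hs))

/-- The form of `(-∂ₓₓ)^s + k` on the energy space. -/
noncomputable def energyForm (hs : 0 < s) (hk : MemLp k ⊤ (volume.restrict (period T))) :
    EnergySpace s T hs →L[ℝ] EnergySpace s T hs →L[ℝ] ℝ :=
  dConst s • ((realInnerCLM (GradSpace s T)).bilinearComp (dxMap hs) (dxMap hs) +
    (realInnerCLM (GradSpace s T)).bilinearComp (dyMap hs) (dyMap hs)) +
      (realInnerCLM (TraceSpace T)).bilinearComp ((mulOp T hk).comp (traceMap hs)) (traceMap hs)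

theorem energyForm_apply (hs : 0 < s) (hk : MemLp k ⊤ (volume.restrict (period T)))
    (h h' : EnergySpace s T hs) : energyForm hs hk h h' =
      dConst s * (⟪dxMap hs h, dxMap hs h'⟫_ℝ + ⟪dyMap hs h, dyMap hs h'⟫_ℝ) +
        ⟪mulOp T hk (traceMap hs h), traceMap hs h'⟫_ℝ := rfl

theorem inner_mulOp (hk : MemLp k ⊤ (volume.restrict (period T))) (f g : TraceSpace T) :
    ⟪mulOp T hk f, g⟫_ℝ = ∫ x in period T, k x * f x * g x := by
  rw [L2.inner_def]
  refine integral_congr_ae ?_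
  filter_upwards [mulOp_coeFn hk f] with x hx
  rw [hx]; simp [mul_comm]

theorem energyForm_symm (hs : 0 < s) (hk : MemLp k ⊤ (volume.restrict (period T)))
    (h h' : EnergySpace s T hs) : energyForm hs hk h h' = energyForm hs hk h' h := by
  rw [energyForm_apply, energyForm_apply, real_inner_comm (dxMap hs h), real_inner_comm (dyMap hs h),
    inner_mulOp, inner_mulOp]
  congr 2
  ext x
  ring

theorem dConst_pos (hs : 0 < s) (hs1 : s < 1) : 0 < dConst s := by
  have h1 := Real.Gamma_pos_of_pos hs
  have h2 := Real.Gamma_pos_of_pos (sub_pos.2 hs1)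
  unfold dConst; positivity

/-- The Gårding inequality. -/
theorem energyForm_garding (hs : 0 < s) (hk : MemLp k ⊤ (volume.restrict (period T)))
    (h : EnergySpace s T hs) : dConst s * ‖h‖ ^ 2 ≤
      energyForm hs hk h h + (‖mulOp T hk‖ + dConst s) * ‖traceMap hs h‖ ^ 2 := by
  have h1 : ‖h‖ ^ 2 = ‖traceMap hs h‖ ^ 2 + (‖dxMap hs h‖ ^ 2 + ‖dyMap hs h‖ ^ 2) :=
    Triple.norm_sq h.toTriple
  have h2 : |⟪mulOp T hk (traceMap hs h), traceMap hs h⟫_ℝ| ≤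
      ‖mulOp T hk‖ * ‖traceMap hs h‖ ^ 2 := by
    refine (abs_real_inner_le_norm _ _).trans ?_
    rw [sq, ← mul_assoc]
    gcongr
    exact (mulOp T hk).le_opNorm _
  rw [energyForm_apply, real_inner_self_eq_norm_sq, real_inner_self_eq_norm_sq, h1]
  linarith [neg_abs_le ⟪mulOp T hk (traceMap hs h), traceMap hs h⟫_ℝ]

variable {U P Q V P' Q' : ℝ × ℝ → ℝ}

/-- The element of the energy space given by a function of finite energy. -/
noncomputable def MemEnergy.toEnergySpace (h : MemEnergy s T U P Q) (hs : 0 < s) :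
    EnergySpace s T hs := ⟨h.toTriple, h.toTriple_mem hs⟩

theorem MemEnergy.traceMap_toEnergySpace (h : MemEnergy s T U P Q) (hs : 0 < s) :
    traceMap hs (h.toEnergySpace hs) = h.trace_mem.memLp.toLp := rfl

theorem inner_toLp_toLp {α : Type*} [MeasurableSpace α] {μ : Measure α} {f g : α → ℝ}
    (hf : MemLp f 2 μ) (hg : MemLp g 2 μ) : ⟪hf.toLp, hg.toLp⟫_ℝ = ∫ x, f x * g x ∂μ := by
  rw [L2.inner_def]
  refine integral_congr_ae ?_
  filter_upwards [hf.coeFn_toLp, hg.coeFn_toLp] with x h1 h2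
  rw [h1, h2]; simp [mul_comm]

theorem form_eq_energyForm (hs : 0 < s) (hk : MemLp k ⊤ (volume.restrict (period T)))
    (hU : MemEnergy s T U P Q) (hV : MemEnergy s T V P' Q') :
    form s T k U P Q V P' Q' =
      energyForm hs hk (hU.toEnergySpace hs) (hV.toEnergySpace hs) := by
  have h1 : Integrable (fun p => P p * P' p) (weight s T) := hU.memLp_dx.integrable_mul hV.memLp_dx
  have h2 : Integrable (fun p => Q p * Q' p) (weight s T) := hU.memLp_dy.integrable_mul hV.memLp_dy
  rw [energyForm_apply, form, integral_add h1 h2, ← inner_toLp_toLp hU.memLp_dx hV.memLp_dx,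
    ← inner_toLp_toLp hU.memLp_dy hV.memLp_dy, inner_mulOp]
  congr 1
  refine integral_congr_ae ?_
  filter_upwards [hU.trace_mem.memLp.coeFn_toLp, hV.trace_mem.memLp.coeFn_toLp] with x h1 h2
  rw [hU.traceMap_toEnergySpace, hV.traceMap_toEnergySpace, h1, h2]

theorem toEnergySpace_extension (hs : 0 < s) (hT : 0 < T) (h : EnergySpace s T hs) :
    (memEnergy_extension hs hT h).toEnergySpace hs = h := by
  refine EnergySpace.toTriple_injective ?_
  have e1 : (memEnergy_extension hs hT h).trace_mem.memLp.toLp = h.toTriple.fst := by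
    refine Lp.ext ?_
    refine (MemLp.coeFn_toLp _).trans ?_
    refine (ae_restrict_iff' (measurableSet_period T)).2 (ae_of_all _ fun x hx => ?_)
    simp only [extension_zero, toIocMod_eq_of_mem_period hT hx]
  have e2 : (memEnergy_extension hs hT h).memLp_dx.toLp = h.toTriple.snd.fst := Lp.toLp_coeFn _ _
  have e3 : (memEnergy_extension hs hT h).memLp_dy.toLp = h.toTriple.snd.snd := Lp.toLp_coeFn _ _
  change WithLp.toLp 2 (_, WithLp.toLp 2 (_, _)) = h.toTriple
  rw [e1, e2, e3]
  rfl

/-- Each vector of the energy space is realised by its `extension`, an admissible test function;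
hence the weak formulation yields the identity against all vectors `h'`. -/
theorem IsWeakSolution.exists_energySpace {f u : ℝ → ℝ} (hs : 0 < s) (hT : 0 < T)
    (hk : MemLp k ⊤ (volume.restrict (period T))) (hu : IsWeakSolution s T k f u)
    (hf : MemL2 T u → MemLp f 2 (volume.restrict (period T))) :
    ∃ (hu : MemL2 T u) (h : EnergySpace s T hs), traceMap hs h = hu.memLp.toLp ∧
      ∀ h', energyForm hs hk h h' = ⟪(hf hu).toLp, traceMap hs h'⟫_ℝ := by
  obtain ⟨U, P, Q, hU, hUu, hweak⟩ := hu
  obtain rfl : (fun x => U (x, 0)) = u := funext hUu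
  refine ⟨hU.trace_mem, hU.toEnergySpace hs, rfl, fun h' => ?_⟩
  have h1 := hweak _ _ _ (memEnergy_extension hs hT h')
  rw [form_eq_energyForm hs hk hU (memEnergy_extension hs hT h'), toEnergySpace_extension] at h1
  rw [h1, ← inner_toLp_toLp (hf hU.trace_mem) (memEnergy_extension hs hT h').trace_mem.memLp,
    ← (memEnergy_extension hs hT h').traceMap_toEnergySpace hs, toEnergySpace_extension]

theorem exists_isWeakSolution (hs : 0 < s) (hT : 0 < T)
    (hk : MemLp k ⊤ (volume.restrict (period T))) (h : EnergySpace s T hs) :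
    ∃ (u : ℝ → ℝ) (hu : MemL2 T u), hu.memLp.toLp = traceMap hs h ∧
      ∀ f (hf : MemLp f 2 (volume.restrict (period T))),
        (∀ h', energyForm hs hk h h' = ⟪hf.toLp, traceMap hs h'⟫_ℝ) → IsWeakSolution s T k f u := by
  have hU := memEnergy_extension hs hT h
  refine ⟨_, hU.trace_mem, ?_, fun f hf hweak => ⟨_, _, _, hU, fun x => rfl, fun V P' Q' hV => ?_⟩⟩
  · rw [← hU.traceMap_toEnergySpace hs, toEnergySpace_extension]
  · rw [form_eq_energyForm hs hk hU hV, toEnergySpace_extension, hweak, hV.traceMap_toEnergySpace,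
      inner_toLp_toLp]

end Form

/-! ### Eigenvalues and unique solvability. -/

section Spectrum

variable {k : ℝ → ℝ}

theorem memEnergy_zero (s T : ℝ) : MemEnergy s T 0 0 0 where
  periodic := by simp
  locallyIntegrable _ := integrableOn_zero
  trace_mem := ⟨fun _ => rfl, MemLp.zero⟩
  memLp_dx := MemLp.zero
  memLp_dy := MemLp.zero
  weak_dx := by simp
  weak_dy := by simp

theorem inner_toLp_const_mul_add {lam : ℝ} {u g : ℝ → ℝ}
    (hu : MemLp u 2 (volume.restrict (period T))) (hg : MemLp g 2 (volume.restrict (period T)))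
    (hf : MemLp (fun x => lam * u x + g x) 2 (volume.restrict (period T))) (v : TraceSpace T) :
    ⟪hf.toLp, v⟫_ℝ = lam * ⟪hu.toLp, v⟫_ℝ + ⟪hg.toLp, v⟫_ℝ := by
  rw [← real_inner_smul_left, ← inner_add_left]; rfl

/-- The issue is nontriviality: an eigenfunction is a nonzero trace, an eigenvector a nonzero
triple. If an eigenvector had zero trace, its form value would be zero, and the Gårding inequality
would make the whole triple vanish. -/
theorem isEigenvalue_iff (hs : 0 < s) (hs1 : s < 1) (hT : 0 < T)
    (hk : MemLp k ⊤ (volume.restrict (period T))) (lam : ℝ) :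
    IsEigenvalue s T k lam ↔ ∃ h : EnergySpace s T hs, h ≠ 0 ∧
      ∀ h', energyForm hs hk h h' = lam * ⟪traceMap hs h, traceMap hs h'⟫_ℝ := by
  have hz : MemLp (0 : ℝ → ℝ) 2 (volume.restrict (period T)) := MemLp.zero
  constructor
  · rintro ⟨u, hu, hu0⟩
    obtain ⟨hu2, h, hh, hweak⟩ := hu.exists_energySpace hs hT hk fun hu => hu.memLp.const_mul lam
    refine ⟨h, fun h0 => hu0 ?_, fun h' => ?_⟩
    · refine ae_eq_of_periodic hT hu2.periodic (fun _ => rfl) ?_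
      rw [h0, map_zero] at hh
      exact (MemLp.toLp_eq_toLp_iff hu2.memLp hz).1
        (hh.symm.trans (MemLp.toLp_zero hz).symm)
    · rw [hweak, hh, ← real_inner_smul_left]; rfl
  · rintro ⟨h, h0, hweak⟩
    obtain ⟨u, hu, hh, hsol⟩ := exists_isWeakSolution hs hT hk h
    refine ⟨u, hsol _ (hu.memLp.const_mul lam) fun h' => ?_, fun hu0 => h0 ?_⟩
    · rw [hweak, ← hh, ← real_inner_smul_left]; rfl
    · have h1 : traceMap hs h = 0 := by
        rw [← hh, ← MemLp.toLp_zero hz]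
        exact (MemLp.toLp_eq_toLp_iff hu.memLp hz).2 (ae_restrict_of_ae hu0)
      have h2 := energyForm_garding hs hk h
      rw [hweak, h1] at h2
      simp only [inner_self_eq_zero.2, norm_zero, mul_zero, ne_eq, OfNat.ofNat_ne_zero,
        not_false_eq_true, zero_pow, add_zero] at h2
      have h3 : ‖h‖ ^ 2 = 0 := le_antisymm
        (nonpos_of_mul_nonpos_right h2 (dConst_pos hs hs1)) (sq_nonneg _)
      exact norm_eq_zero.1 (pow_eq_zero_iff two_ne_zero |>.1 h3)

theorem uniquelySolvable_of_not_isEigenvalue (hs : 0 < s) (hs1 : s < 1) (hT : 0 < T)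
    (hk : MemLp k ⊤ (volume.restrict (period T))) {lam : ℝ} (hlam : ¬ IsEigenvalue s T k lam)
    {g : ℝ → ℝ} (hg : MemL2 T g) : UniquelySolvable s T k lam g := by
  have hinj : ∀ h : EnergySpace s T hs,
      (∀ h', energyForm hs hk h h' = lam * ⟪traceMap hs h, traceMap hs h'⟫_ℝ) → h = 0 :=
    fun h hh => by_contra fun h0 => hlam ((isEigenvalue_iff hs hs1 hT hk lam).2 ⟨h, h0, hh⟩)
  have hf : ∀ u, MemL2 T u → MemLp (fun x => lam * u x + g x) 2 (volume.restrict (period T)) :=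
    fun u hu => (hu.memLp.const_mul lam).add hg.memLp
  constructor
  · obtain ⟨h, hh⟩ := exists_solution_of_garding (H := EnergySpace s T hs) (traceMap hs)
      (isCompactOperator_traceMap hs hT) (energyForm hs hk) (dConst_pos hs hs1)
      (energyForm_garding hs hk) lam hinj hg.memLp.toLp
    obtain ⟨u, hu, hhu, hsol⟩ := exists_isWeakSolution hs hT hk h
    refine ⟨u, hsol _ (hf u hu) fun h' => ?_⟩
    rw [hh, inner_toLp_const_mul_add hu.memLp hg.memLp, hhu]
  · intro u v hu hv
    obtain ⟨hu2, h, hh, hweak⟩ := hu.exists_energySpace hs hT hk (hf u)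
    obtain ⟨hv2, h₂, hh₂, hweak₂⟩ := hv.exists_energySpace hs hT hk (hf v)
    refine ae_eq_of_periodic hT hu2.periodic hv2.periodic
      ((MemLp.toLp_eq_toLp_iff hu2.memLp hv2.memLp).1 ?_)
    rw [← hh, ← hh₂]
    refine congrArg _ (sub_eq_zero.1 (hinj _ fun h' => ?_))
    rw [map_sub, sub_apply, hweak, hweak₂, inner_toLp_const_mul_add hu2.memLp hg.memLp,
      inner_toLp_const_mul_add hv2.memLp hg.memLp, map_sub, inner_sub_left, hh, hh₂]
    ring

theorem finite_eigenvalues_inter_Iic (hs : 0 < s) (hs1 : s < 1) (hT : 0 < T)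
    (hk : MemLp k ⊤ (volume.restrict (period T))) (C : ℝ) :
    ({lam | IsEigenvalue s T k lam} ∩ Iic C).Finite := by
  refine (finite_eigenvalues_of_garding (H := EnergySpace s T hs) (traceMap hs)
    (isCompactOperator_traceMap hs hT) (energyForm hs hk) (energyForm_symm hs hk)
    (dConst_pos hs hs1) (energyForm_garding hs hk) C).subset ?_
  rintro lam ⟨h1, h2⟩
  exact ⟨h2, (isEigenvalue_iff hs hs1 hT hk lam).1 h1⟩

end Spectrum

end PeriodicFractional

theorem theorem2p3 (s T : ℝ) (hs : s ∈ Set.Ioo (0 : ℝ) 1) (hT : 0 < T)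
    (k : ℝ → ℝ) (hk_meas : MeasureTheory.AEStronglyMeasurable k MeasureTheory.volume)
    (hk_per : Function.Periodic k T) (hk_bdd : ∃ M : ℝ, ∀ x, |k x| ≤ M) :
    ∃ S : Set ℝ, S.Countable ∧
      (∀ lam ∈ S, PeriodicFractional.IsEigenvalue s T k lam) ∧
      (∀ lam : ℝ,
        (∀ g : ℝ → ℝ, PeriodicFractional.MemL2 T g →
          PeriodicFractional.UniquelySolvable s T k lam g) ↔ lam ∉ S) ∧
      (S.Infinite → ∃ l : ℕ → ℝ, Monotone l ∧ Set.range l = S ∧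
        Filter.Tendsto l Filter.atTop Filter.atTop) := by
  obtain ⟨M, hM⟩ := hk_bdd
  have hk : MemLp k ⊤ (volume.restrict (PeriodicFractional.period T)) :=
    memLp_top_of_bound hk_meas.restrict M (ae_of_all _ hM)
  have hfin := PeriodicFractional.finite_eigenvalues_inter_Iic hs.1 hs.2 hT hk
  refine ⟨{lam | PeriodicFractional.IsEigenvalue s T k lam}, countable_of_finite_inter_Iic hfin,
    fun lam h => h, fun lam => ⟨fun h hlam => ?_, fun h g hg =>
      PeriodicFractional.uniquelySolvable_of_not_isEigenvalue hs.1 hs.2 hT hk h hg⟩,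
    fun hinf => hinf.exists_monotone_range_eq hfin⟩
  -- At an eigenvalue, uniqueness fails for `g = 0`: both the eigenfunction and zero are solutions.
  obtain ⟨u, hu, hu0⟩ := hlam
  refine hu0 ((h 0 ⟨fun _ => rfl, MemLp.zero⟩).2 u 0 (by simpa using hu) ?_)
  refine ⟨0, 0, 0, PeriodicFractional.memEnergy_zero s T, fun _ => rfl, fun V P' Q' _ => ?_⟩
  simp [PeriodicFractional.form]
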